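/- Fix an infinite set $\Delta$ of data values. Let $AP$ be a finite set of atomic propositions and $A$ a finite set of attributes with a tree order $\le$, i.e. a partial order such that $x^\downarrow=\{y\in A\mid y\le x\}$ is linearly ordered for every $x\in A$. A data word is a finite or infinite sequence $w=(a_0,\mathbf d_0)(a_1,\mathbf d_1)\dots$ with $a_i\subseteq AP$ and $\mathbf d_i:A\to\Delta$; $|w|$ is its length. Formulae of ND-LTL over $(AP,A,\le)$ are the position formulae $\varphi$ of the grammar $$\varphi ::= p\mid\varphi\wedge\varphi\mid\neg\varphi\mid \mathsf X\varphi\mid \mathsf Y\varphi\mid\varphi\,\mathsf U\,\varphi\mid\varphi\,\mathsf S\,\varphi\mid \mathsf C^r_x\psi,$$ $$\psi ::= @x\mid\psi\wedge\psi\mid\neg\psi\mid \mathsf X^=\psi\mid \mathsf Y^=\psi\mid\psi\,\mathsf U^=\psi\mid\psi\,\mathsf S^=\psi\mid\varphi,$$ where $p\in AP$, $x\in A$, $r\in\mathbb Z$. The fragment ND-LTL$^-$ consists of the formulae that use neither $\mathsf X^=$ nor $\mathsf U^=$. For $\mathbf d\in\Delta^{x^\downarrow}$ with $x^\downarrow=\{x_1<\dots<x_n\}$,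 the vector of $\mathbf d$ is $(\mathbf d(x_1),\dots,\mathbf d(x_n))$. Write $\mathbf d\simeq\mathbf d'$ if $\mathbf d$ and $\mathbf d'$ have the same vector, and let $\mathrm{pos}_{\mathbf d}(w)$ be the set of positions $0\le i<|w|$ such that $\mathbf d\simeq \mathbf d_i|_{y^\downarrow}$ for some $y\in A$. Position formulae are interpreted at pairs $(w,i)$ with $0\le i<|w|$, where Boolean connectives and $\mathsf X,\mathsf Y,\mathsf U,\mathsf S$ (next, previous, until, since; $\mathsf X$ and $\mathsf Y$ require that the position moved to exists, and $\mathsf U,\mathsf S$ include the current position) are as usual in LTL with past, and - $(w,i)\models \mathsf C^r_x\psi$ iff $0\le i+r<|w|$ and $(w,i+r,\mathbf d_i|_{x^\downarrow})\models\psi$; - $(w,i,\mathbf d)\models\varphi$ iff $(w,i)\models\varphi$, for position formulae $\varphi$; Boolean connectives of class formulae are as usual; - $(w,i,\mathbf d)\models @x$ iff $\mathbf d_i|_{x^\downarrow}\simeq\mathbf d$; - $(w,i,\mathbf d)\models \mathsf X^=\psi$ iff there is $j>i$ in $\mathrm{pos}_{\mathbf d}(w)$ and, for the smallest such $j$, $(w,j,\mathbf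 d)\models\psi$; - $(w,i,\mathbf d)\models \psi_1\,\mathsf U^=\psi_2$ iff there is $j\ge i$ in $\mathrm{pos}_{\mathbf d}(w)$ with $(w,j,\mathbf d)\models\psi_2$ and $(w,j',\mathbf d)\models\psi_1$ for all $j'\in\mathrm{pos}_{\mathbf d}(w)$ with $i\le j'<j$; - $\mathsf Y^=$ and $\mathsf S^=$ are the mirror images of $\mathsf X^=$ and $\mathsf U^=$ towards the past. A word $w$ satisfies $\varphi$ if $|w|>0$ and $(w,0)\models\varphi$. An input of the satisfiability problem is a triple $(AP,(A,\le),\varphi)$, given by a standard encoding as a string. **Theorem (Undecidability).** The following problems are algorithmically undecidable: 1. given an ND-LTL formula, does some finite data word satisfy it? 2. given an ND-LTL formula, does some infinite data word satisfy it? 3. given an ND-LTL$^-$ formula, does some infinite data word satisfy it? -/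

import Mathlib

namespace NDLTL

universe u v

/-! ### Attributes and multi-attributed data words -/

/-- A tree order: a partial order in which every downward closure is linearly ordered.
Several minimal elements (roots) are allowed. -/
structure IsTreeOrder {A : Type*} (le : A → A → Prop) : Prop where
  refl : ∀ x, le x x
  antisymm : ∀ x y, le x y → le y x → x = y
  trans : ∀ x y z, le x y → le y z → le x z
  chain : ∀ x y z, le x z → le y z → le x y ∨ le y x

/-- A finite or infinite data word over the alphabet of all subsets of `AP`, with attributes `A`
and data values `Δ`. Only the entries `letter i`, `data i` at positions `i < len` belong to the
word; the satisfaction relation below never looks at any other entry. -/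
structure DataWord (AP A Δ : Type*) where
  len : ℕ∞
  letter : ℕ → Set AP
  data : ℕ → A → Δ

/-- `i` is a position of `w`, that is, `0 ≤ i < |w|`. -/
def DataWord.IsPos {AP A Δ : Type*} (w : DataWord AP A Δ) (i : ℕ) : Prop := (i : ℕ∞) < w.len

/-- A mapping from the downward closure of an attribute `top` to data values. -/
structure Valuation {A : Type*} (le : A → A → Prop) (Δ : Type*) where
  top : A
  val : {y : A // le y top} → Δ

/-- The vector `(d x₁, …, d xₙ)`, where `x₁ < x₂ < … < xₙ` are all the elements of the downward
closure on which `d` is defined, is `v`. -/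
def Valuation.HasVector {A Δ : Type*} {le : A → A → Prop} (d : Valuation le Δ) (v : List Δ) :
    Prop :=
  ∃ xs : List {y : A // le y d.top},
    xs.Pairwise (fun a b => le a.1 b.1 ∧ a ≠ b) ∧ (∀ a, a ∈ xs) ∧ xs.map d.val = v

/-- The relation `d ≃ d'`: both mappings have the same vector representation. -/
def Valuation.Equiv {A Δ : Type*} {le : A → A → Prop} (d d' : Valuation le Δ) : Prop :=
  ∃ v : List Δ, d.HasVector v ∧ d'.HasVector v

/-- The restriction of the data valuation at position `i` to the downward closure of `x`. -/
def DataWord.restrict {AP A Δ : Type*} (w : DataWord AP A Δ) (le : A → A → Prop) (i : ℕ) (x : A) :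
    Valuation le Δ :=
  ⟨x, fun y => w.data i y.1⟩

/-- The set of positions of `w` at which the class given by `d` occurs (under some attribute). -/
def DataWord.classPos {AP A Δ : Type*} {le : A → A → Prop} (w : DataWord AP A Δ)
    (d : Valuation le Δ) : Set ℕ :=
  {i | w.IsPos i ∧ ∃ y : A, d.Equiv (w.restrict le i y)}

/-! ### Formulae -/

mutual

/-- Position formulae `φ`. -/
inductive PosFormula (AP : Type u) (A : Type v)
  | atom (p : AP)
  | and (φ₁ φ₂ : PosFormula AP A)
  | neg (φ : PosFormula AP A)
  | X (φ : PosFormula AP A)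
  | Y (φ : PosFormula AP A)
  | U (φ₁ φ₂ : PosFormula AP A)
  | S (φ₁ φ₂ : PosFormula AP A)
  | C (x : A) (r : ℤ) (ψ : ClassFormula AP A)

/-- Class formulae `ψ`; the constructor `same` is the test `@x`, and `Xc`, `Yc`, `Uc`, `Sc` are the
class operators `X⁼`, `Y⁼`, `U⁼`, `S⁼`. -/
inductive ClassFormula (AP : Type u) (A : Type v)
  | same (x : A)
  | and (ψ₁ ψ₂ : ClassFormula AP A)
  | neg (ψ : ClassFormula AP A)
  | Xc (ψ : ClassFormula AP A)
  | Yc (ψ : ClassFormula AP A)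
  | Uc (ψ₁ ψ₂ : ClassFormula AP A)
  | Sc (ψ₁ ψ₂ : ClassFormula AP A)
  | ofPos (φ : PosFormula AP A)

end

mutual

/-- The formula does not use `X⁼` and `U⁼`. -/
def PosFormula.IsMinus {AP : Type u} {A : Type v} : PosFormula AP A → Prop
  | .atom _ => True
  | .and φ₁ φ₂ => φ₁.IsMinus ∧ φ₂.IsMinus
  | .neg φ => φ.IsMinus
  | .X φ => φ.IsMinus
  | .Y φ => φ.IsMinus
  | .U φ₁ φ₂ => φ₁.IsMinus ∧ φ₂.IsMinus
  | .S φ₁ φ₂ => φ₁.IsMinus ∧ φ₂.IsMinus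
  | .C _ _ ψ => ψ.IsMinus

/-- The formula does not use `X⁼` and `U⁼`. -/
def ClassFormula.IsMinus {AP : Type u} {A : Type v} : ClassFormula AP A → Prop
  | .same _ => True
  | .and ψ₁ ψ₂ => ψ₁.IsMinus ∧ ψ₂.IsMinus
  | .neg ψ => ψ.IsMinus
  | .Xc _ => False
  | .Yc ψ => ψ.IsMinus
  | .Uc _ _ => False
  | .Sc ψ₁ ψ₂ => ψ₁.IsMinus ∧ ψ₂.IsMinus
  | .ofPos φ => φ.IsMinus

end

/-! ### Semantics -/

mutual

/-- `(w, i) ⊨ φ`, for a position `i` of `w`. -/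
def PosFormula.Holds {AP A Δ : Type*} (le : A → A → Prop) (w : DataWord AP A Δ) :
    PosFormula AP A → ℕ → Prop
  | .atom p, i => p ∈ w.letter i
  | .and φ₁ φ₂, i => φ₁.Holds le w i ∧ φ₂.Holds le w i
  | .neg φ, i => ¬ φ.Holds le w i
  | .X φ, i => w.IsPos (i + 1) ∧ φ.Holds le w (i + 1)
  | .Y φ, i => ∃ j, j + 1 = i ∧ φ.Holds le w j
  | .U φ₁ φ₂, i => ∃ j, w.IsPos j ∧ i ≤ j ∧ φ₂.Holds le w j ∧
      ∀ k, i ≤ k → k < j → φ₁.Holds le w k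
  | .S φ₁ φ₂, i => ∃ j, j ≤ i ∧ φ₂.Holds le w j ∧ ∀ k, j < k → k ≤ i → φ₁.Holds le w k
  | .C x r ψ, i => ∃ j : ℕ, (j : ℤ) = (i : ℤ) + r ∧ w.IsPos j ∧
      ψ.Holds le w j (w.restrict le i x)

/-- `(w, i, d) ⊨ ψ`, for a position `i` of `w` and a mapping `d` on the downward closure of some
attribute. -/
def ClassFormula.Holds {AP A Δ : Type*} (le : A → A → Prop) (w : DataWord AP A Δ) :
    ClassFormula AP A → ℕ → Valuation le Δ → Prop
  | .same x, i, d => (w.restrict le i x).Equiv d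
  | .and ψ₁ ψ₂, i, d => ψ₁.Holds le w i d ∧ ψ₂.Holds le w i d
  | .neg ψ, i, d => ¬ ψ.Holds le w i d
  | .Xc ψ, i, d => ∃ j ∈ w.classPos d, i < j ∧ (∀ k ∈ w.classPos d, i < k → j ≤ k) ∧
      ψ.Holds le w j d
  | .Yc ψ, i, d => ∃ j ∈ w.classPos d, j < i ∧ (∀ k ∈ w.classPos d, k < i → k ≤ j) ∧
      ψ.Holds le w j d
  | .Uc ψ₁ ψ₂, i, d => ∃ j ∈ w.classPos d, i ≤ j ∧ ψ₂.Holds le w j d ∧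
      ∀ k ∈ w.classPos d, i ≤ k → k < j → ψ₁.Holds le w k d
  | .Sc ψ₁ ψ₂, i, d => ∃ j ∈ w.classPos d, j ≤ i ∧ ψ₂.Holds le w j d ∧
      ∀ k ∈ w.classPos d, j < k → k ≤ i → ψ₁.Holds le w k d
  | .ofPos φ, i, _ => φ.Holds le w i

end

/-! ### Inputs of the satisfiability problems and their encoding as strings -/

/-- An input: finite sets of propositions and of attributes (named by initial segments of `ℕ`), a
tree order on the attributes, and a formula of ND-LTL over them. -/
structure Input where
  numProps : ℕ
  numAttrs : ℕ
  le : Fin numAttrs → Fin numAttrs → Bool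
  isTreeOrder : IsTreeOrder (fun x y => le x y = true)
  formula : PosFormula (Fin numProps) (Fin numAttrs)

mutual

/-- Polish (prefix) notation of a position formula as a string of natural numbers. -/
def PosFormula.code {m n : ℕ} : PosFormula (Fin m) (Fin n) → List ℕ
  | .atom p => [0, p.val]
  | .and φ₁ φ₂ => 1 :: (φ₁.code ++ φ₂.code)
  | .neg φ => 2 :: φ.code
  | .X φ => 3 :: φ.code
  | .Y φ => 4 :: φ.code
  | .U φ₁ φ₂ => 5 :: (φ₁.code ++ φ₂.code)
  | .S φ₁ φ₂ => 6 :: (φ₁.code ++ φ₂.code)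
  | .C x r ψ => 7 :: x.val :: r.toNat :: (-r).toNat :: ψ.code

/-- Polish (prefix) notation of a class formula as a string of natural numbers. -/
def ClassFormula.code {m n : ℕ} : ClassFormula (Fin m) (Fin n) → List ℕ
  | .same x => [0, x.val]
  | .and ψ₁ ψ₂ => 1 :: (ψ₁.code ++ ψ₂.code)
  | .neg ψ => 2 :: ψ.code
  | .Xc ψ => 3 :: ψ.code
  | .Yc ψ => 4 :: ψ.code
  | .Uc ψ₁ ψ₂ => 5 :: (ψ₁.code ++ ψ₂.code)
  | .Sc ψ₁ ψ₂ => 6 :: (ψ₁.code ++ ψ₂.code)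
  | .ofPos φ => 7 :: φ.code

end

/-- The string presented to an algorithm: the two cardinalities, the table of the tree order row by
row, and the formula. -/
def Input.code (I : Input) : List ℕ :=
  I.numProps :: I.numAttrs ::
    ((List.finRange I.numAttrs).flatMap
        (fun x => (List.finRange I.numAttrs).map (fun y => (I.le x y).toNat)) ++
      I.formula.code)

mutual

theorem PosFormula.code_append_inj {m n : ℕ} (φ φ' : PosFormula (Fin m) (Fin n)) (l l' : List ℕ)
    (h : φ.code ++ l = φ'.code ++ l') : φ = φ' ∧ l = l' := by
  cases φ with
  | atom p => cases φ' <;> simp [PosFormula.code, Fin.val_inj] at h ⊢; exact h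
  | and a b =>
    cases φ' <;> simp [PosFormula.code] at h ⊢
    obtain ⟨h1, h2⟩ := PosFormula.code_append_inj a _ _ _ h
    obtain ⟨h3, h4⟩ := PosFormula.code_append_inj b _ _ _ h2
    exact ⟨⟨h1, h3⟩, h4⟩
  | neg a =>
    cases φ' <;> simp [PosFormula.code] at h ⊢
    exact PosFormula.code_append_inj a _ _ _ h
  | X a =>
    cases φ' <;> simp [PosFormula.code] at h ⊢
    exact PosFormula.code_append_inj a _ _ _ h
  | Y a =>
    cases φ' <;> simp [PosFormula.code] at h ⊢
    exact PosFormula.code_append_inj a _ _ _ h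
  | U a b =>
    cases φ' <;> simp [PosFormula.code] at h ⊢
    obtain ⟨h1, h2⟩ := PosFormula.code_append_inj a _ _ _ h
    obtain ⟨h3, h4⟩ := PosFormula.code_append_inj b _ _ _ h2
    exact ⟨⟨h1, h3⟩, h4⟩
  | S a b =>
    cases φ' <;> simp [PosFormula.code] at h ⊢
    obtain ⟨h1, h2⟩ := PosFormula.code_append_inj a _ _ _ h
    obtain ⟨h3, h4⟩ := PosFormula.code_append_inj b _ _ _ h2
    exact ⟨⟨h1, h3⟩, h4⟩
  | C x r ψ =>
    cases φ' <;> simp [PosFormula.code, Fin.val_inj] at h ⊢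
    obtain ⟨h1, h2, h3, h4⟩ := h
    obtain ⟨h5, h6⟩ := ClassFormula.code_append_inj ψ _ _ _ h4
    exact ⟨⟨h1, by omega, h5⟩, h6⟩

theorem ClassFormula.code_append_inj {m n : ℕ} (φ φ' : ClassFormula (Fin m) (Fin n))
    (l l' : List ℕ) (h : φ.code ++ l = φ'.code ++ l') : φ = φ' ∧ l = l' := by
  cases φ with
  | same x => cases φ' <;> simp [ClassFormula.code, Fin.val_inj] at h ⊢; exact h
  | and a b =>
    cases φ' <;> simp [ClassFormula.code] at h ⊢
    obtain ⟨h1, h2⟩ := ClassFormula.code_append_inj a _ _ _ h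
    obtain ⟨h3, h4⟩ := ClassFormula.code_append_inj b _ _ _ h2
    exact ⟨⟨h1, h3⟩, h4⟩
  | neg a =>
    cases φ' <;> simp [ClassFormula.code] at h ⊢
    exact ClassFormula.code_append_inj a _ _ _ h
  | Xc a =>
    cases φ' <;> simp [ClassFormula.code] at h ⊢
    exact ClassFormula.code_append_inj a _ _ _ h
  | Yc a =>
    cases φ' <;> simp [ClassFormula.code] at h ⊢
    exact ClassFormula.code_append_inj a _ _ _ h
  | Uc a b =>
    cases φ' <;> simp [ClassFormula.code] at h ⊢
    obtain ⟨h1, h2⟩ := ClassFormula.code_append_inj a _ _ _ h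
    obtain ⟨h3, h4⟩ := ClassFormula.code_append_inj b _ _ _ h2
    exact ⟨⟨h1, h3⟩, h4⟩
  | Sc a b =>
    cases φ' <;> simp [ClassFormula.code] at h ⊢
    obtain ⟨h1, h2⟩ := ClassFormula.code_append_inj a _ _ _ h
    obtain ⟨h3, h4⟩ := ClassFormula.code_append_inj b _ _ _ h2
    exact ⟨⟨h1, h3⟩, h4⟩
  | ofPos a =>
    cases φ' <;> simp [ClassFormula.code] at h ⊢
    exact PosFormula.code_append_inj a _ _ _ h

end

/-- Different inputs have different encodings. -/
theorem Input.code_injective : Function.Injective Input.code := by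
  rintro ⟨m, n, le, h, φ⟩ ⟨m', n', le', h', φ'⟩ e
  simp only [Input.code, List.cons.injEq] at e
  obtain ⟨rfl, rfl, e⟩ := e
  obtain ⟨e1, e2⟩ := List.append_inj e (by simp [List.length_flatMap])
  have e3 : le = le' := by
    rw [List.flatMap_def, List.flatMap_def] at e1
    have e4 := List.eq_iff_flatten_eq.2 ⟨e1, by simp [Function.comp_def]⟩
    funext x y
    have e5 := List.map_inj_left.1 e4 x (by simp)
    have e6 := List.map_inj_left.1 e5 y (by simp)
    revert e6
    cases le x y <;> cases le' x y <;> simp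
  subst e3
  have e6 := (PosFormula.code_append_inj φ φ' [] [] (by simpa using e2)).1
  subst e6
  rfl

/-! ### The satisfiability problems -/

/-- `w ⊨ φ` for the formula of the input: the word has a position `0`, and `(w, 0) ⊨ φ`. -/
def Input.Models {Δ : Type*} (I : Input) (w : DataWord (Fin I.numProps) (Fin I.numAttrs) Δ) :
    Prop :=
  w.IsPos 0 ∧ I.formula.Holds (fun x y => I.le x y = true) w 0

/-- The formula is satisfied by some finite data word. -/
def Input.FinSat (Δ : Type*) (I : Input) : Prop :=
  ∃ w : DataWord (Fin I.numProps) (Fin I.numAttrs) Δ, w.len < ⊤ ∧ I.Models w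

/-- The formula is satisfied by some infinite data word. -/
def Input.InfSat (Δ : Type*) (I : Input) : Prop :=
  ∃ w : DataWord (Fin I.numProps) (Fin I.numAttrs) Δ, w.len = ⊤ ∧ I.Models w

/-- The problem `P`, for inputs from `D`, is decidable: some total computable function answers it
correctly on the encoding of every input in `D`. -/
def DecidableOn (D : Set Input) (P : Input → Prop) : Prop :=
  ∃ f : List ℕ → Bool, Computable f ∧ ∀ I ∈ D, (f I.code = true ↔ P I)

end NDLTL

namespace NDLTL

-- The halting problem of one fixed nondeterministic register program `p`
-- (`exists_undecidable_prog`) is reduced to satisfiability. The input `n` enters the formula as a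
-- block of `n` load positions. A position of the word carries one label: a continuation of `p` or a
-- bookkeeping mark. Counter values are not stored but encoded by data. Each counter owns a root
-- attribute, whose value is kept between zero tests and is fresh at each of them, and a child
-- attribute; the pair of values names a unit. Every decrement must have an increment as the
-- previous position of its class. Two decrements cannot share that increment, since the earlier one
-- would lie in between. So decrements are matched injectively to earlier increments of the same
-- segment (`IsLinked.exists_matching`), and no decrement happens at value zero
-- (`Matching.val_pos`). This needs past operators only, but a zero test may then silently discard
-- units: it acts as a reset.
--
-- On finite words, `X⁼` also demands a decrement for every increment, within its segment. Nothing
-- is then pending at a zero test (`Matching.val_eq_zero`), and the run is exact.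
--
-- On infinite words no future class operator is needed. An initial phase fills a budget, counter 0;
-- each register increment is paid from it and each decrement refunds it. After that phase the total
-- of all counters never grows, and it drops whenever a zero test discards something
-- (`Lab.total_le`). The formula asks for infinitely many rounds of `p`, only finitely many drops
-- are possible, and so a late round is an exact terminating execution (`exec_of_infinite_run`).
--
-- Conversely, terminating executions of `p` end with empty registers, so one of them can be
-- repeated forever on a large enough budget (`exists_round`). Suitable data values arise by pairing
-- the `q`-th increment of a counter with its `q`-th decrement (`names_of_count_eq`).

/-! ### Register programs -/

/-- Nondeterministic register programs: regular expressions over increments, decrements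
and zero tests. -/
inductive RegProg
  | skip
  | inc (r : ℕ)
  | dec (r : ℕ)
  | zero (r : ℕ)
  | seq (p q : RegProg)
  | star (p : RegProg)

namespace RegProg

/-- The input-output relation of a program on register contents. -/
def Exec : RegProg → (ℕ → ℕ) → (ℕ → ℕ) → Prop
  | skip => fun σ τ => τ = σ
  | inc r => fun σ τ => τ = Function.update σ r (σ r + 1)
  | dec r => fun σ τ => 0 < σ r ∧ τ = Function.update σ r (σ r - 1)
  | zero r => fun σ τ => σ r = 0 ∧ τ = σ
  | seq p q => fun σ τ => ∃ ρ, p.Exec σ ρ ∧ q.Exec ρ τ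
  | star p => Relation.ReflTransGen p.Exec

/-- From `σ`, the program `p` can terminate, and then it does so in `τ`. -/
def Maps (p : RegProg) (σ τ : ℕ → ℕ) : Prop := ∀ τ', p.Exec σ τ' ↔ τ' = τ

theorem Maps.seq {p q : RegProg} {σ τ ρ : ℕ → ℕ} (hp : p.Maps σ τ) (hq : q.Maps τ ρ) :
    (p.seq q).Maps σ ρ := by
  intro τ'
  simp only [Exec]
  constructor
  · rintro ⟨a, ha, hb⟩
    rw [(hp a).1 ha] at hb
    exact (hq _).1 hb
  · rintro rfl
    exact ⟨τ, (hp _).2 rfl, (hq _).2 rfl⟩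

theorem Maps.congr {p : RegProg} {σ τ τ' : ℕ → ℕ} (hp : p.Maps σ τ) (h : τ = τ') :
    p.Maps σ τ' := h ▸ hp

theorem maps_skip (σ : ℕ → ℕ) : skip.Maps σ σ := fun _ => Iff.rfl

theorem maps_inc (r : ℕ) (σ : ℕ → ℕ) : (inc r).Maps σ (Function.update σ r (σ r + 1)) :=
  fun _ => Iff.rfl

/-- Execute `p` once for every unit of register `a`, which is counted down to `0`. -/
def loop (a : ℕ) (p : RegProg) : RegProg := seq (star (seq (dec a) p)) (zero a)

/-- `F j` is the state after `j` passes. The star may be left early, but then the closing zero test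
fails, so only one outcome remains. -/
theorem maps_loop {a : ℕ} {p : RegProg} (F : ℕ → ℕ → ℕ) (N : ℕ)
    (hF : ∀ j ≤ N, F j a = N - j)
    (hp : ∀ j < N, p.Maps (Function.update (F j) a (N - j - 1)) (F (j + 1))) :
    (loop a p).Maps (F 0) (F N) := by
  intro τ
  simp only [loop, Exec]
  constructor
  · rintro ⟨ρ, h, h0, rfl⟩
    have key : ∃ j ≤ N, τ = F j := by
      clear h0
      induction h with
      | refl => exact ⟨0, Nat.zero_le _, rfl⟩
      | tail _ hs ih =>
        obtain ⟨b', ⟨hpos, rfl⟩, hb⟩ := hs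
        obtain ⟨j, hj, rfl⟩ := ih
        rw [hF j hj] at hpos hb
        exact ⟨j + 1, by omega, (hp j (by omega) _).1 hb⟩
    obtain ⟨j, hj, rfl⟩ := key
    rw [hF j hj] at h0
    rw [show j = N by omega]
  · rintro rfl
    refine ⟨F N, ?_, by simp [hF], rfl⟩
    have : ∀ j ≤ N, Relation.ReflTransGen
        (fun σ τ => ∃ ρ, (0 < σ a ∧ ρ = Function.update σ a (σ a - 1)) ∧ p.Exec ρ τ)
        (F 0) (F j) := by
      intro j
      induction j with
      | zero => intro _; exact .refl
      | succ j ih =>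
        intro hj
        refine (ih (by omega)).tail ⟨_, ⟨?_, rfl⟩, ?_⟩
        · rw [hF j (by omega)]; omega
        · rw [hF j (by omega)]; exact (hp j (by omega) _).2 rfl
    exact this N le_rfl

/-- Set register `r` to `0`. -/
def clear (r : ℕ) : RegProg := loop r skip

theorem maps_clear (r : ℕ) (σ : ℕ → ℕ) : (clear r).Maps σ (Function.update σ r 0) := by
  have := maps_loop (a := r) (p := skip) (fun j => Function.update σ r (σ r - j)) (σ r)
    (by intros; simp) (by
      intro j _
      refine (maps_skip _).congr ?_
      simp [Nat.sub_sub])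
  simpa [clear] using this

/-- Add register `a` to register `b` and set `a` to `0`. -/
def move (a b : ℕ) : RegProg := loop a (inc b)

theorem maps_move {a b : ℕ} (hab : a ≠ b) (σ : ℕ → ℕ) :
    (move a b).Maps σ (Function.update (Function.update σ b (σ b + σ a)) a 0) := by
  have := maps_loop (a := a) (p := inc b)
    (fun j => Function.update (Function.update σ b (σ b + j)) a (σ a - j)) (σ a)
    (by intros; simp) (by
      intro j _
      refine (maps_inc _ _).congr ?_
      funext r
      by_cases h1 : r = a <;> by_cases h2 : r = b <;> simp_all [Function.update_apply] <;> omega)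
  simpa [move] using this

/-- Add register `a` to register `b`, using the register `t` as temporary storage. -/
def copy (a b t : ℕ) : RegProg := seq (loop a (seq (inc b) (inc t))) (move t a)

theorem maps_copy {a b t : ℕ} (hab : a ≠ b) (hat : a ≠ t) (hbt : b ≠ t) (σ : ℕ → ℕ)
    (ht : σ t = 0) : (copy a b t).Maps σ (Function.update σ b (σ b + σ a)) := by
  have := maps_loop (a := a) (p := seq (inc b) (inc t))
    (fun j => Function.update (Function.update (Function.update σ b (σ b + j)) t j)
      a (σ a - j)) (σ a)
    (by intros; simp) (by
      intro j _
      refine ((maps_inc _ _).seq (maps_inc _ _)).congr ?_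
      funext r
      by_cases h1 : r = a <;> by_cases h2 : r = b <;> by_cases h3 : r = t <;>
        simp_all [Function.update_apply] <;> omega)
  have h2 := this.seq (maps_move (Ne.symm hat) _)
  have e : Function.update (Function.update (Function.update σ b (σ b + 0)) t 0)
      a (σ a - 0) = σ := by
    funext r
    by_cases h1 : r = a <;> by_cases h2 : r = b <;> by_cases h3 : r = t <;>
        simp_all [Function.update_apply]
  rw [e] at h2
  refine h2.congr ?_
  clear h2 this e
  have hta := hat.symm
  have hba := hab.symm
  funext r
  by_cases h1 : r = a <;> by_cases h2 : r = b <;> by_cases h3 : r = t <;>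
        simp_all

/-! ### Primitive recursive functions are computed by programs -/

/-- For every choice of input registers, output register and start of the scratch area,
some program adds the value of `f` to the output register and changes nothing else. -/
def Implements {n : ℕ} (f : List.Vector ℕ n → ℕ) : Prop :=
  ∀ (inp : Fin n → ℕ) (out s : ℕ), (∀ i, inp i < s) → (∀ i, inp i ≠ out) → out < s →
    ∃ p : RegProg, ∀ σ : ℕ → ℕ, (∀ r, s ≤ r → σ r = 0) →
      p.Maps σ (Function.update σ out (σ out + f (List.Vector.ofFn fun i => σ (inp i))))

theorem exists_clearRange (s n : ℕ) : ∃ p : RegProg, ∀ σ : ℕ → ℕ,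
    p.Maps σ (fun r => if s ≤ r ∧ r < s + n then 0 else σ r) := by
  induction n with
  | zero =>
    refine ⟨skip, fun σ => (maps_skip σ).congr ?_⟩
    funext r
    rw [if_neg (by omega)]
  | succ n ih =>
    obtain ⟨p, hp⟩ := ih
    refine ⟨seq p (clear (s + n)), fun σ => ((hp σ).seq (maps_clear _ _)).congr ?_⟩
    funext r
    by_cases h : r = s + n
    · simp [h]
    · simp only [Function.update_apply, h, if_false]
      congr 1
      simp only [eq_iff_iff]
      omega

/-- Results go to `s`, `s + 1`, …, while all scratch starts at `s + n`, so no evaluation disturbs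
earlier results or the inputs below `s`. -/
theorem exists_evalAll {m n : ℕ} {g : Fin n → List.Vector ℕ m → ℕ}
    (hg : ∀ i, Implements (g i)) (inp : Fin m → ℕ) (s : ℕ) (hinp : ∀ i, inp i < s) (j : ℕ)
    (hj : j ≤ n) : ∃ p : RegProg, ∀ σ : ℕ → ℕ, (∀ r, s ≤ r → σ r = 0) →
      p.Maps σ (fun r => if h : s ≤ r ∧ r < s + j then
        g ⟨r - s, by omega⟩ (List.Vector.ofFn fun i => σ (inp i)) else σ r) := by
  induction j with
  | zero =>
    refine ⟨skip, fun σ _ => (maps_skip σ).congr ?_⟩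
    funext r
    rw [dif_neg (by omega)]
  | succ j ih =>
    obtain ⟨p, hp⟩ := ih (by omega)
    obtain ⟨q, hq⟩ := hg ⟨j, by omega⟩ inp (s + j) (s + n)
      (fun i => by have := hinp i; omega) (fun i => by have := hinp i; omega) (by omega)
    refine ⟨seq p q, fun σ hσ => ((hp σ hσ).seq (hq _ ?_)).congr ?_⟩
    · intro r hr
      rw [dif_neg (by omega)]
      exact hσ r (by omega)
    · have e : ∀ i, (if h : s ≤ inp i ∧ inp i < s + j then
        g ⟨inp i - s, by omega⟩ (List.Vector.ofFn fun i => σ (inp i)) else σ (inp i)) =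
          σ (inp i) := fun i => dif_neg (by have := hinp i; omega)
      simp only [e]
      funext r
      by_cases h : r = s + j
      · subst h
        simp [hσ]
      · simp only [Function.update_apply, h, if_false]
        by_cases h' : s ≤ r ∧ r < s + j
        · rw [dif_pos h', dif_pos (by omega)]
        · rw [dif_neg h', dif_neg (by omega)]

theorem Implements.comp {m n : ℕ} {f : List.Vector ℕ n → ℕ} {g : Fin n → List.Vector ℕ m → ℕ}
    (hf : Implements f) (hg : ∀ i, Implements (g i)) :
    Implements fun a => f (List.Vector.ofFn fun i => g i a) := by
  intro inp out s hinp hne hout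
  obtain ⟨p, hp⟩ := exists_evalAll hg inp s hinp n le_rfl
  obtain ⟨q, hq⟩ := hf (fun i => s + i) out (s + n) (fun i => by have := i.2; omega)
    (fun i => by omega) (by omega)
  obtain ⟨c, hc⟩ := exists_clearRange s n
  refine ⟨seq p (seq q c), fun σ hσ => ((hp σ hσ).seq ((hq _ ?_).seq (hc _))).congr ?_⟩
  · intro r hr
    rw [dif_neg (by omega)]
    exact hσ r (by omega)
  · funext r
    by_cases h : s ≤ r ∧ r < s + n
    · rw [if_pos h, Function.update_of_ne (by omega), hσ r h.1]
    · rw [if_neg h]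
      by_cases h' : r = out
      · subst h'
        simp [h]
      · simp [h', h]

/-- Register plan: `s` holds the recursion index, `s + 1` the value so far, `s + 2` the next value,
`s + 3` the number of passes left; scratch starts at `s + 4`. -/
theorem Implements.prec {n : ℕ} {f : List.Vector ℕ n → ℕ} {g : List.Vector ℕ (n + 2) → ℕ}
    (hf : Implements f) (hg : Implements g) :
    Implements fun v : List.Vector ℕ (n + 1) =>
      v.head.rec (f v.tail) fun y IH => g (y ::ᵥ IH ::ᵥ v.tail) := by
  intro inp out s hinp hne hout
  obtain ⟨p, hp⟩ := hf (fun i => inp i.succ) (s + 1) (s + 4)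
    (fun i => by have := hinp i.succ; omega) (fun i => by have := hinp i.succ; omega) (by omega)
  obtain ⟨q, hq⟩ := hg (Fin.cons s (Fin.cons (s + 1) fun i => inp i.succ)) (s + 2) (s + 4)
    (fun i => by
      have h := fun i : Fin n => hinp i.succ
      refine Fin.cases ?_ (fun i => Fin.cases ?_ (fun i => ?_) i) i <;> simp
      have := h i
      omega)
    (fun i => by
      have h := fun i : Fin n => hinp i.succ
      refine Fin.cases ?_ (fun i => Fin.cases ?_ (fun i => ?_) i) i <;> simp
      have := h i
      omega)
    (by omega)
  refine ⟨seq (seq p (copy (inp 0) (s + 3) (s + 4)))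
    (seq (loop (s + 3) (seq q (seq (clear (s + 1)) (seq (move (s + 2) (s + 1)) (inc s)))))
      (seq (move (s + 1) out) (clear s))), fun σ hσ => ?_⟩
  set w : List.Vector ℕ n := List.Vector.ofFn fun i => σ (inp i.succ) with hw
  obtain ⟨h, hz, hs, hh⟩ : ∃ h : ℕ → ℕ, h 0 = f w ∧ (∀ j, h (j + 1) = g (j ::ᵥ h j ::ᵥ w)) ∧
      ∀ j, h j = Nat.rec (f w) (fun y IH => g (y ::ᵥ IH ::ᵥ w)) j :=
    ⟨fun j => Nat.rec (f w) (fun y IH => g (y ::ᵥ IH ::ᵥ w)) j, rfl, fun _ => rfl, fun _ => rfl⟩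
  have hi : ∀ i, inp i < s := hinp
  have hi0 := hinp 0
  have ev : (List.Vector.ofFn fun i => σ (inp i)) = σ (inp 0) ::ᵥ w := by
    rw [hw]; rfl
  set F : ℕ → ℕ → ℕ := fun j r =>
    if r = s then j else if r = s + 1 then h j else if r = s + 3 then σ (inp 0) - j else σ r
    with hFdef
  have h0 : σ s = 0 := hσ _ (by omega)
  have h1 : σ (s + 1) = 0 := hσ _ (by omega)
  have h2 : σ (s + 2) = 0 := hσ _ (by omega)
  have h3 : σ (s + 3) = 0 := hσ _ (by omega)
  have h4 : σ (s + 4) = 0 := hσ _ (by omega)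
  have A : (seq p (copy (inp 0) (s + 3) (s + 4))).Maps σ (F 0) := by
    refine ((hp σ fun r hr => hσ r (by omega)).seq
      (maps_copy (by omega) (by omega) (by omega) _ ?_)).congr ?_
    · simp [h4]
    · funext r
      simp only [Function.update_apply, hFdef, hz, ← hw]
      clear_value w
      split_ifs <;> simp_all
  have B : (loop (s + 3) (seq q (seq (clear (s + 1)) (seq (move (s + 2) (s + 1))
      (inc s))))).Maps (F 0) (F (σ (inp 0))) := by
    refine maps_loop F _ ?_ ?_
    · intro j _; simp [hFdef]
    · intro j hj
      refine ((hq _ ?_).seq ((maps_clear _ _).seq ((maps_move (by omega) _).seq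
        (maps_inc _ _)))).congr ?_
      · intro r hr
        simp only [Function.update_apply, hFdef]
        split_ifs <;> first | omega | exact hσ r (by omega)
      · have ew : (List.Vector.ofFn fun i => Function.update (F j) (s + 3) (σ (inp 0) - j - 1)
            ((Fin.cons s (Fin.cons (s + 1) fun i => inp i.succ) : Fin (n + 2) → ℕ) i)) =
            j ::ᵥ h j ::ᵥ w := by
          have et : ∀ i : Fin n, Function.update (F j) (s + 3) (σ (inp 0) - j - 1)
              (inp i.succ) = σ (inp i.succ) := by
            intro i
            have := hinp i.succ
            simp only [Function.update_apply, hFdef]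
            split_ifs <;> omega
          simp only [List.Vector.ofFn, Fin.cons_zero, Fin.cons_succ, et]
          rw [← hw]
          simp [hFdef]
        rw [ew]
        funext r
        simp only [Function.update_apply, hFdef, hs]
        by_cases r0 : r = s
        · simp [r0]
        by_cases r1 : r = s + 1
        · simp [r1, h2]
        by_cases r2 : r = s + 2
        · simp [r2, h2]
        by_cases r3 : r = s + 3
        · simp [r3, Nat.sub_sub]
        simp [r0, r1, r2, r3]
  refine (A.seq (B.seq ((maps_move (by omega) _).seq (maps_clear _ _)))).congr ?_
  rw [ev]
  simp only [List.Vector.head_cons, List.Vector.tail_cons, ← hh]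
  funext r
  simp only [Function.update_apply, hFdef]
  have o0 : out ≠ s := by omega
  have o1 : out ≠ s + 1 := by omega
  have o3 : out ≠ s + 3 := by omega
  by_cases r0 : r = s
  · simp [r0, h0, o0.symm]
  by_cases r1 : r = s + 1
  · simp [r1, h1, o1.symm]
  by_cases r3 : r = s + 3
  · simp [r3, h3, o3.symm]
  by_cases ro : r = out
  · simp [ro, o0, o1, o3]
  simp [r0, r1, r3, ro]

theorem implements_of_primrec {n : ℕ} {f : List.Vector ℕ n → ℕ} (hf : Nat.Primrec' f) :
    Implements f := by
  induction hf with
  | zero => exact fun inp out s _ _ _ => ⟨skip, fun σ _ => (maps_skip σ).congr (by simp)⟩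
  | succ =>
    intro inp out s hi hne ho
    refine ⟨seq (copy (inp 0) out s) (inc out), fun σ hσ =>
      ((maps_copy (hne 0) (by have := hi 0; omega) (by omega) σ (hσ s le_rfl)).seq
        (maps_inc _ _)).congr ?_⟩
    funext r
    by_cases h : r = out <;> simp [h, Nat.add_assoc]
  | get i =>
    intro inp out s hi hne ho
    exact ⟨copy (inp i) out s, fun σ hσ =>
      (maps_copy (hne i) (by have := hi i; omega) (by omega) σ (hσ s le_rfl)).congr (by simp)⟩
  | comp g _ _ hf hg => exact hf.comp hg
  | prec _ _ hf hg => exact hf.prec hg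

/-! ### A program with an undecidable halting problem -/

/-- `T` is fuel-bounded evaluation of a code at input `0`, with value `0` for success. Halting thus
becomes one guess followed by a primitive recursive check. -/
theorem exists_undecidable_projection : ∃ T : List.Vector ℕ 2 → ℕ, Nat.Primrec' T ∧
    ¬ ComputablePred fun n : ℕ => ∃ k, T (n ::ᵥ k ::ᵥ List.Vector.nil) = 0 := by
  let T : List.Vector ℕ 2 → ℕ := fun v =>
    if (Nat.Partrec.Code.evaln (v.get 1) (Denumerable.ofNat Nat.Partrec.Code (v.get 0)) 0).isSome
      then 0 else 1
  have hT : Primrec T := by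
    have h0 : Primrec fun v : List.Vector ℕ 2 => v.get 0 :=
      Primrec.vector_get.comp Primrec.id (Primrec.const 0)
    have h1 : Primrec fun v : List.Vector ℕ 2 => v.get 1 :=
      Primrec.vector_get.comp Primrec.id (Primrec.const 1)
    have h2 : Primrec fun v : List.Vector ℕ 2 =>
        (Nat.Partrec.Code.evaln (v.get 1) (Denumerable.ofNat Nat.Partrec.Code (v.get 0)) 0) :=
      Nat.Partrec.Code.primrec_evaln.comp
        ((h1.pair ((Primrec.ofNat Nat.Partrec.Code).comp h0)).pair (Primrec.const 0))
    have h3 := Primrec.option_isSome.comp h2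
    exact (Primrec.cond h3 (Primrec.const 0) (Primrec.const 1)).of_eq fun v => by
      simp only [T]
      cases (Nat.Partrec.Code.evaln (v.get 1)
        (Denumerable.ofNat Nat.Partrec.Code (v.get 0)) 0).isSome <;> simp
  refine ⟨T, Nat.Primrec'.prim_iff.2 hT, fun h => ?_⟩
  refine ComputablePred.halting_problem 0 ?_
  have h' : ComputablePred fun c : Nat.Partrec.Code =>
      ∃ k, T (Encodable.encode c ::ᵥ k ::ᵥ List.Vector.nil) = 0 := by
    obtain ⟨hd, hc⟩ := h
    exact ⟨fun c => hd (Encodable.encode c), hc.comp Computable.encode⟩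
  refine h'.of_eq fun c => ?_
  have : ∀ k, T (Encodable.encode c ::ᵥ k ::ᵥ List.Vector.nil) = 0 ↔
      (Nat.Partrec.Code.evaln k c 0).isSome := by
    intro k
    have e0 : (Encodable.encode c ::ᵥ k ::ᵥ List.Vector.nil).get 0 = Encodable.encode c := rfl
    have e1 : (Encodable.encode c ::ᵥ k ::ᵥ List.Vector.nil).get 1 = k := rfl
    simp only [T, e0, e1, Denumerable.ofNat_encode]
    split_ifs with hk <;> simp_all
  simp only [this, Part.dom_iff_mem, Nat.Partrec.Code.evaln_complete, Option.isSome_iff_exists]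
  exact exists_comm

/-- `star (inc 1)` guesses the fuel and the zero test keeps only successful guesses. Clearing the
registers at the end is what allows rounds to be repeated on the same budget. -/
theorem exists_undecidable_prog : ∃ p : RegProg,
    (∀ n τ, p.Exec (Function.update (0 : ℕ → ℕ) 0 n) τ → τ = 0) ∧
    ¬ ComputablePred fun n : ℕ => ∃ τ, p.Exec (Function.update (0 : ℕ → ℕ) 0 n) τ := by
  obtain ⟨T, hT, hund⟩ := exists_undecidable_projection
  -- Inputs in registers 0 and 1, output in 2, scratch from 3.
  obtain ⟨p, hp⟩ := implements_of_primrec hT (fun i => i) 2 3 (fun i => by omega)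
    (fun i => by omega) (by omega)
  suffices key : ∀ n ρ, (seq (star (inc 1)) (seq p (seq (zero 2) (seq (clear 0)
      (clear 1))))).Exec (Function.update (0 : ℕ → ℕ) 0 n) ρ ↔
      ρ = 0 ∧ ∃ k, T (n ::ᵥ k ::ᵥ List.Vector.nil) = 0 from
    ⟨_, fun n ρ h => ((key n ρ).1 h).1, fun h => hund (h.of_eq fun n => by simp [key])⟩
  intro n ρ₀
  set τ : ℕ → ℕ → ℕ := fun k => Function.update (Function.update (0 : ℕ → ℕ) 0 n) 1 k with hτ
  have hstar : ∀ ρ, (star (inc 1)).Exec (Function.update (0 : ℕ → ℕ) 0 n) ρ ↔ ∃ k, ρ = τ k := by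
    intro ρ
    constructor
    · intro h
      induction h with
      | refl => exact ⟨0, by funext r; by_cases h : r = 1 <;> simp [hτ, h]⟩
      | tail _ h ih =>
        obtain ⟨k, rfl⟩ := ih
        simp only [Exec] at h
        exact ⟨k + 1, by rw [h]; simp [hτ]⟩
    · rintro ⟨k, rfl⟩
      induction k with
      | zero =>
        have : τ 0 = Function.update (0 : ℕ → ℕ) 0 n := by
          funext r; by_cases h : r = 1 <;> simp [hτ, h]
        rw [this]; exact .refl
      | succ k ih =>
        refine ih.tail ?_
        simp [Exec, hτ]
  have hrun : ∀ k, p.Maps (τ k) (Function.update (τ k) 2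
      (T (n ::ᵥ k ::ᵥ List.Vector.nil))) := by
    intro k
    refine (hp (τ k) fun r hr => ?_).congr ?_
    · simp [hτ, show r ≠ 0 by omega, show r ≠ 1 by omega]
    · have e1 : τ k 2 = 0 := by simp [hτ]
      rw [e1, Nat.zero_add]
      rfl
  have hend : ∀ ρ, (seq (clear 0) (clear 1)).Maps ρ
      (Function.update (Function.update ρ 0 0) 1 0) :=
    fun ρ => (maps_clear _ _).seq (maps_clear _ _)
  have hfin : ∀ k, T (n ::ᵥ k ::ᵥ List.Vector.nil) = 0 → Function.update (Function.update
      (Function.update (τ k) 2 (T (n ::ᵥ k ::ᵥ List.Vector.nil))) 0 0) 1 0 = 0 := by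
    intro k hk
    funext r
    simp only [Function.update_apply, hk, hτ, Pi.zero_apply]
    split_ifs <;> rfl
  constructor
  · rintro ⟨ρ, h1, ρ', h2, ρ'', ⟨h3, h3'⟩, h4⟩
    obtain ⟨k, rfl⟩ := (hstar _).1 h1
    rw [(hrun k _).1 h2] at h3 h3'
    have hk : T (n ::ᵥ k ::ᵥ List.Vector.nil) = 0 := by simpa using h3
    rw [h3'] at h4
    exact ⟨((hend _ _).1 h4).trans (hfin k hk), k, hk⟩
  · rintro ⟨rfl, k, hk⟩
    exact ⟨τ k, (hstar _).2 ⟨k, rfl⟩, _, (hrun k _).2 rfl, _, ⟨by simpa using hk, rfl⟩,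
      (hend _ _).2 (hfin k hk).symm⟩

end RegProg
namespace RegProg

/-! ### Small-step execution -/

/-- The control flow between continuations, which are stacks of programs still to be run. -/
inductive Next : List RegProg → List RegProg → Prop
  | skip (k) : Next (skip :: k) k
  | inc (r k) : Next (inc r :: k) k
  | dec (r k) : Next (dec r :: k) k
  | zero (r k) : Next (zero r :: k) k
  | seq (p q k) : Next (seq p q :: k) (p :: q :: k)
  | starExit (p k) : Next (star p :: k) k
  | starLoop (p k) : Next (star p :: k) (p :: star p :: k)

/-- The action on registers of the first step of a continuation. -/
def act : List RegProg → (ℕ → ℕ) → (ℕ → ℕ) → Prop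
  | inc r :: _ => (inc r).Exec
  | dec r :: _ => (dec r).Exec
  | zero r :: _ => (zero r).Exec
  | _ => fun σ τ => τ = σ

/-- Execution of the programs of a list one after the other. -/
def ExecList : List RegProg → (ℕ → ℕ) → (ℕ → ℕ) → Prop
  | [] => fun σ τ => τ = σ
  | p :: k => fun σ τ => ∃ ρ, p.Exec σ ρ ∧ ExecList k ρ τ

theorem execList_of_next {s s' : List RegProg} {σ ρ τ : ℕ → ℕ} (h : Next s s')
    (ha : act s σ ρ) (hl : ExecList s' ρ τ) : ExecList s σ τ := by
  cases h with
  | skip k => exact ⟨ρ, ha, hl⟩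
  | inc r k => exact ⟨ρ, ha, hl⟩
  | dec r k => exact ⟨ρ, ha, hl⟩
  | zero r k => exact ⟨ρ, ha, hl⟩
  | seq p q k =>
    simp only [act] at ha
    subst ha
    obtain ⟨a, h1, b, h2, h3⟩ := hl
    exact ⟨b, ⟨a, h1, h2⟩, h3⟩
  | starExit p k =>
    simp only [act] at ha
    subst ha
    exact ⟨ρ, .refl, hl⟩
  | starLoop p k =>
    simp only [act] at ha
    subst ha
    obtain ⟨a, h1, b, h2, h3⟩ := hl
    exact ⟨b, .head h1 h2, h3⟩

/-- One step on pairs of a continuation and register contents. -/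
def Step (x y : List RegProg × (ℕ → ℕ)) : Prop := Next x.1 y.1 ∧ act x.1 x.2 y.2

/-- The stack `k` below has to be arbitrary, because `seq` and `star` push their remaining work onto
it. -/
theorem Exec.steps {p : RegProg} {σ τ : ℕ → ℕ} (h : p.Exec σ τ) (k : List RegProg) :
    Relation.ReflTransGen Step (p :: k, σ) (k, τ) := by
  induction p generalizing σ τ k with
  | skip => exact .single ⟨.skip k, h⟩
  | inc r => exact .single ⟨.inc r k, h⟩
  | dec r => exact .single ⟨.dec r k, h⟩
  | zero r => exact .single ⟨.zero r k, h⟩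
  | seq p q hp hq =>
    obtain ⟨ρ, h1, h2⟩ := h
    exact .head (b := (p :: q :: k, σ)) ⟨.seq p q k, rfl⟩ ((hp h1 (q :: k)).trans (hq h2 k))
  | star p hp =>
    have hexit : Relation.ReflTransGen Step (star p :: k, τ) (k, τ) :=
      .single ⟨.starExit p k, rfl⟩
    refine Relation.ReflTransGen.trans ?_ hexit
    simp only [Exec] at h
    induction h with
    | refl => exact .refl
    | @tail b c _ h2 ih =>
      exact (ih (.single ⟨.starExit p k, rfl⟩)).trans
        (.head (b := (p :: star p :: k, b)) ⟨.starLoop p k, rfl⟩ (hp h2 _))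

/-- The continuations reachable from `p :: k` before `p` is finished. -/
def conts : RegProg → List RegProg → Set (List RegProg)
  | seq p q, k => {seq p q :: k} ∪ (conts p (q :: k) ∪ conts q k)
  | star p, k => {star p :: k} ∪ conts p (star p :: k)
  | p, k => {p :: k}

theorem conts_finite (p : RegProg) (k : List RegProg) : (conts p k).Finite := by
  induction p generalizing k with
  | seq p q hp hq =>
    exact (Set.finite_singleton _).union ((hp _).union (hq _))
  | star p hp => exact (Set.finite_singleton _).union (hp _)
  | _ => exact Set.finite_singleton _

theorem mem_conts_self (p : RegProg) (k : List RegProg) : p :: k ∈ conts p k := by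
  cases p <;> simp [conts]

/-- Together with `conts_finite` this makes the control finite, so that continuations can serve as
propositions. -/
theorem conts_closed {p : RegProg} {k s s' : List RegProg} (hs : s ∈ conts p k)
    (h : Next s s') : s' ∈ conts p k ∨ s' = k := by
  induction p generalizing k with
  | skip => obtain rfl : s = _ := hs; cases h; exact Or.inr rfl
  | inc r => obtain rfl : s = _ := hs; cases h; exact Or.inr rfl
  | dec r => obtain rfl : s = _ := hs; cases h; exact Or.inr rfl
  | zero r => obtain rfl : s = _ := hs; cases h; exact Or.inr rfl
  | seq p q hp hq =>
    simp only [conts, Set.mem_union, Set.mem_singleton_iff] at hs ⊢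
    rcases hs with rfl | hs | hs
    · cases h; exact Or.inl (Or.inr (Or.inl (mem_conts_self _ _)))
    · rcases hp hs with h | rfl
      · exact Or.inl (Or.inr (Or.inl h))
      · exact Or.inl (Or.inr (Or.inr (mem_conts_self _ _)))
    · rcases hq hs with h | rfl
      · exact Or.inl (Or.inr (Or.inr h))
      · exact Or.inr rfl
  | star p hp =>
    simp only [conts, Set.mem_union, Set.mem_singleton_iff] at hs ⊢
    rcases hs with rfl | hs
    · cases h
      · exact Or.inr rfl
      · exact Or.inl (Or.inr (mem_conts_self _ _))
    · rcases hp hs with h | rfl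
      · exact Or.inl (Or.inr h)
      · exact Or.inl (Or.inl rfl)

end RegProg

/-! ### Counters -/

/-- The effect of a position of a word on a counter. -/
inductive Eff
  | nop
  | inc
  | dec
  | zero
  deriving DecidableEq

/-- The effect on the value of a counter, where a zero test resets the counter. -/
def Eff.apply : Eff → ℕ → ℕ
  | nop, x => x
  | inc, x => x + 1
  | dec, x => x - 1
  | zero, _ => 0

/-- The effect is possible in a counter machine with exact zero tests. -/
def Eff.Ok : Eff → ℕ → Prop
  | dec, x => 0 < x
  | zero, x => x = 0
  | _, _ => True

/-- The value of a counter after `t` effects. -/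
def val (e : ℕ → Eff) : ℕ → ℕ
  | 0 => 0
  | t + 1 => (e t).apply (val e t)

theorem val_eq_zero {e : ℕ → Eff} {t : ℕ} (h : ∀ i < t, e i ≠ .inc) : val e t = 0 := by
  induction t with
  | zero => rfl
  | succ t ih =>
    have h1 := ih fun i hi => h i (by omega)
    have h2 := h t (by omega)
    rw [val, h1]
    cases he : e t <;> simp_all [Eff.apply]

/-- Among the first `L` positions, each decrement of the counter with effects `e` is assigned an
earlier increment by the injective map `m`, with no zero test in between. -/
structure Matching (e : ℕ → Eff) (L : ℕ∞) (m : ℕ → ℕ) : Prop where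
  lt : ∀ t : ℕ, t < L → e t = .dec → m t < t
  inc : ∀ t : ℕ, t < L → e t = .dec → e (m t) = .inc
  no_zero : ∀ t : ℕ, t < L → e t = .dec → ∀ z, m t < z → z ≤ t → e z ≠ .zero
  inj : ∀ t t' : ℕ, t < L → t' < L → e t = .dec → e t' = .dec → m t = m t' → t = t'

/-- The increments before `t`, after the last zero test, that are not yet used by a decrement. -/
def pending (e : ℕ → Eff) (m : ℕ → ℕ) (t : ℕ) : Set ℕ :=
  {i | i < t ∧ e i = .inc ∧ (∀ z, i < z → z < t → e z ≠ .zero) ∧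
    ∀ j < t, e j = .dec → m j ≠ i}

theorem pending_finite (e : ℕ → Eff) (m : ℕ → ℕ) (t : ℕ) : (pending e m t).Finite :=
  (Set.finite_Iio t).subset fun _ h => h.1

theorem Matching.mem_pending {e : ℕ → Eff} {L : ℕ∞} {m : ℕ → ℕ} (h : Matching e L m) {t : ℕ}
    (ht : t < L) (hd : e t = .dec) : m t ∈ pending e m t := by
  refine ⟨h.lt t ht hd, h.inc t ht hd, fun z h1 h2 => h.no_zero t ht hd z h1 h2.le,
    fun j hj hdj hm => ?_⟩
  have hjL : (j : ℕ∞) < L := lt_trans (by exact_mod_cast hj) ht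
  exact hj.ne (h.inj j t hjL ht hdj hd hm)

/-- An increment adds itself, a decrement removes its partner, which was pending by
`Matching.mem_pending`, and a zero test discards everything. -/
theorem Matching.val_eq {e : ℕ → Eff} {L : ℕ∞} {m : ℕ → ℕ} (h : Matching e L m) (t : ℕ)
    (ht : t ≤ L) : val e t = (pending e m t).ncard := by
  induction t with
  | zero =>
    have : pending e m 0 = ∅ := by ext i; simp [pending]
    simp [this, val]
  | succ t ih =>
    have htL : (t : ℕ∞) < L := lt_of_lt_of_le (by exact_mod_cast Nat.lt_succ_self t) ht
    rw [val, ih htL.le]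
    cases he : e t with
    | nop =>
      have : pending e m (t + 1) = pending e m t := by
        ext i
        constructor
        · rintro ⟨h1, h2, h3, h4⟩
          have : i ≠ t := by rintro rfl; simp [he] at h2
          exact ⟨by omega, h2, fun z a b => h3 z a (by omega), fun j hj => h4 j (by omega)⟩
        · rintro ⟨h1, h2, h3, h4⟩
          refine ⟨by omega, h2, fun z a b => ?_, fun j hj hd => ?_⟩
          · rcases Nat.lt_succ_iff_lt_or_eq.1 b with b | rfl
            · exact h3 z a b
            · simp [he]
          · rcases Nat.lt_succ_iff_lt_or_eq.1 hj with b | rfl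
            · exact h4 j b hd
            · simp [he] at hd
      rw [this]; rfl
    | inc =>
      have : pending e m (t + 1) = insert t (pending e m t) := by
        ext i
        constructor
        · rintro ⟨h1, h2, h3, h4⟩
          by_cases hi : i = t
          · exact Or.inl hi
          · exact Or.inr ⟨by omega, h2, fun z a b => h3 z a (by omega),
              fun j hj => h4 j (by omega)⟩
        · rintro (rfl | ⟨h1, h2, h3, h4⟩)
          · refine ⟨by omega, he, fun z a b => by omega, fun j hj hd hm => ?_⟩
            have hjL : (j : ℕ∞) < L := lt_of_lt_of_le (by exact_mod_cast hj) ht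
            have := h.lt j hjL hd
            omega
          · refine ⟨by omega, h2, fun z a b => ?_, fun j hj hd => ?_⟩
            · rcases Nat.lt_succ_iff_lt_or_eq.1 b with b | rfl
              · exact h3 z a b
              · simp [he]
            · rcases Nat.lt_succ_iff_lt_or_eq.1 hj with b | rfl
              · exact h4 j b hd
              · simp [he] at hd
      rw [this, Set.ncard_insert_of_notMem (fun hm => lt_irrefl t hm.1) (pending_finite e m t)]
      rfl
    | dec =>
      have : pending e m (t + 1) = pending e m t \ {m t} := by
        ext i
        constructor
        · rintro ⟨h1, h2, h3, h4⟩
          have : i ≠ t := by rintro rfl; simp [he] at h2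
          exact ⟨⟨by omega, h2, fun z a b => h3 z a (by omega), fun j hj => h4 j (by omega)⟩,
            fun hi => h4 t (by omega) he hi.symm⟩
        · rintro ⟨⟨h1, h2, h3, h4⟩, h5⟩
          refine ⟨by omega, h2, fun z a b => ?_, fun j hj hd => ?_⟩
          · rcases Nat.lt_succ_iff_lt_or_eq.1 b with b | rfl
            · exact h3 z a b
            · simp [he]
          · rcases Nat.lt_succ_iff_lt_or_eq.1 hj with b | rfl
            · exact h4 j b hd
            · exact fun hm => h5 hm.symm
      rw [this, Set.ncard_sdiff_singleton_of_mem (h.mem_pending htL he)]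
      rfl
    | zero =>
      have : pending e m (t + 1) = ∅ := by
        ext i
        simp only [Set.mem_empty_iff_false, iff_false]
        rintro ⟨h1, h2, h3, h4⟩
        have : i ≠ t := by rintro rfl; simp [he] at h2
        exact h3 t (by omega) (by omega) he
      rw [this]; simp [Eff.apply]

theorem Matching.val_pos {e : ℕ → Eff} {L : ℕ∞} {m : ℕ → ℕ} (h : Matching e L m) {t : ℕ}
    (ht : t < L) (hd : e t = .dec) : 0 < val e t := by
  rw [h.val_eq t ht.le, Set.ncard_pos (pending_finite e m t)]
  exact ⟨_, h.mem_pending ht hd⟩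

/-- The decrement of a unit pending at `t` could not be earlier, where it would have used the unit
up, nor at `t`, nor later, where the matching would cross the zero test. -/
theorem Matching.val_eq_zero {e : ℕ → Eff} {L : ℕ∞} {m : ℕ → ℕ} (h : Matching e L m)
    (hf : ∀ i : ℕ, i < L → e i = .inc → ∃ j : ℕ, j < L ∧ i < j ∧ e j = .dec ∧ m j = i) {t : ℕ}
    (ht : t < L) (hz : e t = .zero) : val e t = 0 := by
  rw [h.val_eq t ht.le, Set.ncard_eq_zero (pending_finite e m t)]
  ext i
  simp only [Set.mem_empty_iff_false, iff_false]
  rintro ⟨h1, h2, h3, h4⟩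
  obtain ⟨j, hj, hij, hd, hm⟩ := hf i (lt_trans (by exact_mod_cast h1) ht) h2
  rcases lt_trichotomy j t with hjt | rfl | hjt
  · exact h4 j hjt hd hm
  · simp [hz] at hd
  · exact h.no_zero j hj hd t (by omega) hjt.le hz

open RegProg

/-! ### Labels of positions -/

/-- The labels of positions: building up the budget, starting a round, loading the input, and
running a program. Counter `0` is the budget, counter `r + 1` is register `r`. -/
inductive Lab
  | pre
  | mark
  | load
  | st (s : List RegProg)

/-- The effect of the first step of a continuation on the counters. -/
def stEff : List RegProg → ℕ → Eff
  | inc r :: _, c => if c = 0 then .dec else if c = r + 1 then .inc else .nop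
  | dec r :: _, c => if c = 0 then .inc else if c = r + 1 then .dec else .nop
  | zero r :: _, c => if c = r + 1 then .zero else .nop
  | _, _ => .nop

/-- The effect of a label on the counters. -/
def Lab.eff : Lab → ℕ → Eff
  | pre, c => if c = 0 then .inc else .nop
  | mark, c => if c = 0 then .nop else .zero
  | load, c => if c = 0 then .dec else if c = 1 then .inc else .nop
  | st s, c => stEff s c

/-- The pairs of labels that may follow each other. -/
def Lab.Adj (p : RegProg) : Lab → Lab → Prop
  | pre, x => x = pre ∨ x = mark
  | mark, x => x = load ∨ x = st [p]
  | load, x => x = load ∨ x = st [p]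
  | st s, st s' => Next s s'
  | st s, mark => s = []
  | st _, _ => False

/-- The counter values before position `t`. -/
def vals (ℓ : ℕ → Lab) (t c : ℕ) : ℕ := val (fun i => (ℓ i).eff c) t

theorem vals_succ (ℓ : ℕ → Lab) (t c : ℕ) :
    vals ℓ (t + 1) c = ((ℓ t).eff c).apply (vals ℓ t c) := rfl

/-- The budget is invisible to the program. A zero test at value zero changes nothing, so reset and
test agree. -/
theorem act_of_eff {s s' : List RegProg} {v v' : ℕ → ℕ} (hs : Next s s')
    (hv : ∀ c, v' c = (stEff s c).apply (v c)) (ok : ∀ c, (stEff s c).Ok (v c)) :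
    act s (fun r => v (r + 1)) (fun r => v' (r + 1)) := by
  cases hs with
  | inc r k =>
    simp only [act, Exec]
    funext x
    rw [hv]
    by_cases h : x = r <;> simp [stEff, h, Eff.apply]
  | dec r k =>
    simp only [act, Exec]
    refine ⟨by simpa [stEff, Eff.Ok] using ok (r + 1), ?_⟩
    funext x
    rw [hv]
    by_cases h : x = r <;> simp [stEff, h, Eff.apply]
  | zero r k =>
    simp only [act, Exec]
    have h0 : v (r + 1) = 0 := by simpa [stEff, Eff.Ok] using ok (r + 1)
    refine ⟨h0, ?_⟩
    funext x
    rw [hv]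
    by_cases h : x = r <;> simp [stEff, h, Eff.apply, h0]
  | _ =>
    simp only [act]
    funext x
    rw [hv]
    simp [stEff, Eff.apply]

/-- A round of a run in which all effects are possible yields an execution of the program. -/
theorem exec_of_round {p : RegProg} {n : ℕ} {ℓ : ℕ → Lab} {i j : ℕ} (hm : ℓ i = .mark)
    (hl : ∀ d < n, ℓ (i + 1 + d) = .load) (hs : ℓ (i + 1 + n) = .st [p]) (hij : i + 1 + n ≤ j)
    (hh : ℓ j = .st []) (adj : ∀ t, i ≤ t → t < j → Lab.Adj p (ℓ t) (ℓ (t + 1)))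
    (ok : ∀ t, i ≤ t → t < j → ∀ c, ((ℓ t).eff c).Ok (vals ℓ t c)) :
    ∃ τ, p.Exec (Function.update (0 : ℕ → ℕ) 0 n) τ := by
  -- Whatever the registers held, `mark` resets them; then `d` loads put `d` into register 0.
  have h1 : ∀ d ≤ n, (fun r => vals ℓ (i + 1 + d) (r + 1)) = Function.update (0 : ℕ → ℕ) 0 d := by
    intro d
    induction d with
    | zero =>
      intro _
      funext r
      have : vals ℓ (i + 1 + 0) (r + 1) = 0 := by
        rw [Nat.add_zero, vals_succ, hm]
        simp [Lab.eff, Eff.apply]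
      rw [this]
      by_cases h : r = 0 <;> simp [h]
    | succ d ih =>
      intro hd
      have ih := ih (by omega)
      funext r
      have := congrFun ih r
      rw [← Nat.add_assoc, vals_succ, hl d (by omega), this]
      by_cases h : r = 0 <;> simp [h, Lab.eff, Eff.apply]
  -- Position `j` may lie in a later round. Before the first halting label after the start, only
  -- continuations can occur.
  have hex : ∃ e, ℓ (i + 1 + n + e) = .st [] := ⟨j - (i + 1 + n), by
    rw [show i + 1 + n + (j - (i + 1 + n)) = j by omega]; exact hh⟩
  classical
  set e := Nat.find hex with he
  have he' : ℓ (i + 1 + n + e) = .st [] := Nat.find_spec hex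
  have hmin : ∀ d < e, ℓ (i + 1 + n + d) ≠ .st [] := fun d hd => Nat.find_min hex hd
  have hej : i + 1 + n + e ≤ j := by
    have : e ≤ j - (i + 1 + n) := Nat.find_min' hex (by
      rw [show i + 1 + n + (j - (i + 1 + n)) = j by omega]; exact hh)
    omega
  -- The invariant looks forward: every completion of the current continuation yields an execution
  -- of `p` from the start. At `e` the continuation is empty and the completion trivial.
  have key : ∀ d ≤ e, ∃ s, ℓ (i + 1 + n + d) = .st s ∧ ∀ τ,
      ExecList s (fun r => vals ℓ (i + 1 + n + d) (r + 1)) τ →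
        p.Exec (Function.update (0 : ℕ → ℕ) 0 n) τ := by
    intro d
    induction d with
    | zero =>
      intro _
      refine ⟨[p], hs, fun τ h => ?_⟩
      rw [Nat.add_zero, h1 n le_rfl] at h
      obtain ⟨ρ, h2, rfl⟩ := h
      exact h2
    | succ d ih =>
      intro hd
      obtain ⟨s, hs, hx⟩ := ih (by omega)
      have ha := adj (i + 1 + n + d) (by omega) (by omega)
      have hk := ok (i + 1 + n + d) (by omega) (by omega)
      rw [hs] at ha hk
      have hne : s ≠ [] := by
        rintro rfl
        exact hmin d (by omega) hs
      cases hl : ℓ (i + 1 + n + d + 1) with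
      | st s' =>
        rw [hl] at ha
        refine ⟨s', rfl, fun τ hτ => hx τ (execList_of_next ha ?_ hτ)⟩
        refine act_of_eff (v' := vals ℓ (i + 1 + n + d + 1)) ha ?_ hk
        intro c
        rw [vals_succ, hs]
        rfl
      | mark => rw [hl] at ha; exact absurd ha hne
      | pre => rw [hl] at ha; exact ha.elim
      | load => rw [hl] at ha; exact ha.elim
  obtain ⟨s, hs, hx⟩ := key e le_rfl
  rw [he'] at hs
  cases hs
  exact ⟨_, hx _ rfl⟩

-- Conservation of the total counter value

theorem sum_transfer {k a b : ℕ} {v v' : ℕ → ℕ} (ha : a < k) (hb : b < k) (hab : a ≠ b)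
    (h1 : 0 < v a) (h2 : v' a = v a - 1) (h3 : v' b = v b + 1)
    (h4 : ∀ c, c ≠ a → c ≠ b → v' c = v c) :
    ∑ c ∈ Finset.range k, v' c = ∑ c ∈ Finset.range k, v c := by
  have hA : a ∈ Finset.range k := by simpa
  have hB : b ∈ (Finset.range k).erase a := by simp [hb, hab.symm]
  rw [← Finset.add_sum_erase _ _ hA, ← Finset.add_sum_erase _ _ hB,
    ← Finset.add_sum_erase _ v hA, ← Finset.add_sum_erase _ v hB]
  have : ∑ x ∈ ((Finset.range k).erase a).erase b, v' x =
      ∑ x ∈ ((Finset.range k).erase a).erase b, v x :=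
    Finset.sum_congr rfl fun c hc => by
      simp only [Finset.mem_erase] at hc
      exact h4 c hc.2.1 hc.1
  omega

/-- Outside the initial phase an increment always comes with a decrement: units only move between
the budget and a register. -/
theorem Lab.eff_cases {x : Lab} (hx : x ≠ .pre) : (∀ c, x.eff c ≠ .inc) ∨
    ∃ a b, a ≠ b ∧ x.eff a = .dec ∧ x.eff b = .inc ∧ ∀ c, c ≠ a → c ≠ b → x.eff c = .nop := by
  cases x with
  | pre => exact absurd rfl hx
  | mark => left; intro c; simp only [Lab.eff]; split_ifs <;> simp
  | load => exact Or.inr ⟨0, 1, by simp, rfl, rfl, fun c h1 h2 => by simp [Lab.eff, h1, h2]⟩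
  | st s =>
    match s with
    | inc r :: _ =>
      exact Or.inr ⟨0, r + 1, by simp, by simp [Lab.eff, stEff], by simp [Lab.eff, stEff],
        fun c h1 h2 => by simp [Lab.eff, stEff, h1, h2]⟩
    | dec r :: _ =>
      exact Or.inr ⟨r + 1, 0, by simp, by simp [Lab.eff, stEff], by simp [Lab.eff, stEff],
        fun c h1 h2 => by simp [Lab.eff, stEff, h1, h2]⟩
    | zero r :: _ => left; intro c; simp only [Lab.eff, stEff]; split_ifs <;> simp
    | [] | skip :: _ | seq _ _ :: _ | RegProg.star _ :: _ =>
      left; intro c; simp [Lab.eff, stEff]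

/-- Transfers preserve the total, and `hk` ensures that both of their ends are summed. Given `hd`,
the only effect that can fail to be `Ok` is a zero test of a positive counter, whose reset loses
units. -/
theorem Lab.total_le {x : Lab} (hx : x ≠ .pre) {k : ℕ} {v : ℕ → ℕ}
    (hk : ∀ c, x.eff c = .inc ∨ x.eff c = .dec → c < k) (hd : ∀ c, x.eff c = .dec → 0 < v c) :
    ∑ c ∈ Finset.range k, (x.eff c).apply (v c) ≤ ∑ c ∈ Finset.range k, v c ∧
    ((∃ c < k, ¬ (x.eff c).Ok (v c)) →
      ∑ c ∈ Finset.range k, (x.eff c).apply (v c) < ∑ c ∈ Finset.range k, v c) := by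
  rcases x.eff_cases hx with h | ⟨a, b, hab, ha, hb, hc⟩
  · have hle : ∀ c, (x.eff c).apply (v c) ≤ v c := by
      intro c
      have := h c
      cases hxc : x.eff c <;> simp_all [Eff.apply]
    refine ⟨Finset.sum_le_sum fun c _ => hle c, fun ⟨c, hck, hok⟩ =>
      Finset.sum_lt_sum (fun c _ => hle c) ⟨c, by simpa, ?_⟩⟩
    have hdc := hd c
    cases hxc : x.eff c <;> simp_all [Eff.Ok, Eff.apply]
    omega
  · have hs := sum_transfer (v := v) (v' := fun c => (x.eff c).apply (v c)) (hk a (Or.inr ha))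
      (hk b (Or.inl hb)) hab (hd a ha) (by simp [ha, Eff.apply]) (by simp [hb, Eff.apply])
      (fun c h1 h2 => by simp [hc c h1 h2, Eff.apply])
    refine ⟨hs.le, fun ⟨c, hck, hok⟩ => absurd ?_ hok⟩
    by_cases h1 : c = a
    · subst h1; simpa [ha, Eff.Ok] using hd c ha
    by_cases h2 : c = b
    · subst h2; simp [hb, Eff.Ok]
    simp [hc c h1 h2, Eff.Ok]

-- Control structure, and executions extracted from runs

/-- The control part of a run: consecutive labels fit, and every round loads the number `n`. -/
structure IsControl (p : RegProg) (n : ℕ) (L : ℕ∞) (ℓ : ℕ → Lab) : Prop where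
  init : ℓ 0 = .pre ∨ ℓ 0 = .mark
  adj : ∀ t : ℕ, ((t + 1 : ℕ) : ℕ∞) < L → Lab.Adj p (ℓ t) (ℓ (t + 1))
  load : ∀ i : ℕ, i < L → ℓ i = .mark → ((i + 1 + n : ℕ) : ℕ∞) < L ∧
    (∀ d < n, ℓ (i + 1 + d) = .load) ∧ ℓ (i + 1 + n) = .st [p]

theorem IsControl.exists_mark {p : RegProg} {n : ℕ} {L : ℕ∞} {ℓ : ℕ → Lab}
    (h : IsControl p n L ℓ) {t : ℕ} (ht : t < L) (hp : ℓ t ≠ .pre) : ∃ i ≤ t, ℓ i = .mark := by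
  induction t with
  | zero => exact ⟨0, le_rfl, h.init.resolve_left hp⟩
  | succ t ih =>
    have htL : (t : ℕ∞) < L := lt_trans (by exact_mod_cast Nat.lt_succ_self t) ht
    by_cases ht' : ℓ t = .pre
    · have := h.adj t ht
      rw [ht'] at this
      exact ⟨t + 1, le_rfl, this.resolve_left hp⟩
    · obtain ⟨i, hi, hm⟩ := ih htL ht'
      exact ⟨i, by omega, hm⟩

theorem Lab.Adj.ne_pre {p : RegProg} {x y : Lab} (h : Lab.Adj p x y) (hx : x ≠ .pre) :
    y ≠ .pre := by
  cases x <;> cases y <;> simp_all [Lab.Adj]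

theorem exec_of_finite_run {p : RegProg} {n L : ℕ} {ℓ : ℕ → Lab}
    (h : IsControl p n (L + 1 : ℕ) ℓ) (hlast : ℓ L = .st [])
    (ok : ∀ t ≤ L, ∀ c, ((ℓ t).eff c).Ok (vals ℓ t c)) :
    ∃ τ, p.Exec (Function.update (0 : ℕ → ℕ) 0 n) τ := by
  obtain ⟨i, hi, hm⟩ := h.exists_mark (t := L) (by exact_mod_cast Nat.lt_succ_self L)
    (by simp [hlast])
  obtain ⟨h1, h2, h3⟩ := h.load i (by exact_mod_cast Nat.lt_succ_of_le hi) hm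
  have h1 : i + 1 + n < L + 1 := by exact_mod_cast h1
  exact exec_of_round hm h2 h3 (by omega) hlast
    (fun t _ ht => h.adj t (by exact_mod_cast Nat.succ_lt_succ ht)) (fun t _ ht => ok t ht.le)

/-- No `pre` follows the first halting label, so from there on the total `W` is antitone. Past a
point where it is minimal nothing can be lost, and any round lying there is exact. -/
theorem exec_of_infinite_run {p : RegProg} {n k : ℕ} {ℓ : ℕ → Lab} (h : IsControl p n ⊤ ℓ)
    (hrec : ∀ t, ∃ t' ≥ t, ℓ t' = .st [])
    (hk : ∀ t c, (ℓ t).eff c = .inc ∨ (ℓ t).eff c = .dec → c < k)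
    (hd : ∀ t c, (ℓ t).eff c = .dec → 0 < vals ℓ t c) :
    ∃ τ, p.Exec (Function.update (0 : ℕ → ℕ) 0 n) τ := by
  have adj : ∀ t, Lab.Adj p (ℓ t) (ℓ (t + 1)) := fun t => h.adj t (ENat.natCast_lt_top _)
  obtain ⟨t0, -, ht0⟩ := hrec 0
  have hpre : ∀ d, ℓ (t0 + d) ≠ .pre := by
    intro d
    induction d with
    | zero => simp [ht0]
    | succ d ih => exact (adj _).ne_pre ih
  set W : ℕ → ℕ := fun d => ∑ c ∈ Finset.range k, vals ℓ (t0 + d) c with hW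
  have hstep : ∀ d, W (d + 1) ≤ W d ∧
      ((∃ c < k, ¬ ((ℓ (t0 + d)).eff c).Ok (vals ℓ (t0 + d) c)) → W (d + 1) < W d) :=
    fun d => Lab.total_le (hpre d) (hk _) (hd _)
  have hanti : Antitone W := antitone_nat_of_succ_le fun d => (hstep d).1
  obtain ⟨d0, hd0⟩ : ∃ d0, ∀ d, W d0 ≤ W d := by
    have := (measure W).wf.has_min Set.univ ⟨0, trivial⟩
    obtain ⟨d0, -, hd0⟩ := this
    exact ⟨d0, fun d => not_lt.1 (hd0 d trivial)⟩
  have hexact : ∀ d ≥ d0, ∀ c, ((ℓ (t0 + d)).eff c).Ok (vals ℓ (t0 + d) c) := by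
    intro d hdd c
    by_cases hc : c < k
    · by_contra hcon
      have h1 := (hstep d).2 ⟨c, hc, hcon⟩
      have h2 := hd0 (d + 1)
      have h3 := hanti hdd
      omega
    -- Counters outside the sum are never incremented, so they stay zero and even a zero test on
    -- them is exact.
    · have hv : vals ℓ (t0 + d) c = 0 := val_eq_zero fun i _ hi => hc (hk i c (Or.inl hi))
      have := fun hx => hc (hk (t0 + d) c (Or.inr hx))
      rw [hv]
      cases he : (ℓ (t0 + d)).eff c <;> simp_all [Eff.Ok]
  -- A halting label can only be followed by `mark`, so a complete round starts inside the exact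
  -- part.
  obtain ⟨t1, ht1, hh⟩ := hrec (t0 + d0)
  have hm : ℓ (t1 + 1) = .mark := by
    have h1 := adj t1
    rw [hh] at h1
    cases hl : ℓ (t1 + 1) with
    | mark => rfl
    | st s => rw [hl] at h1; cases h1
    | _ => rw [hl] at h1; exact h1.elim
  obtain ⟨-, h2, h3⟩ := h.load (t1 + 1) (ENat.natCast_lt_top _) hm
  obtain ⟨t2, ht2, hh2⟩ := hrec (t1 + 1 + 1 + n)
  refine exec_of_round hm h2 h3 ht2 hh2 (fun t _ _ => adj t) (fun t ht _ c => ?_)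
  have := hexact (t - t0) (by omega) c
  rwa [show t0 + (t - t0) = t by omega] at this

open RegProg

/-! ### Construction of runs -/

theorem exists_path {α : Type*} {R : α → α → Prop} {a b : α} (h : Relation.ReflTransGen R a b) :
    ∃ (g : ℕ → α) (p : ℕ), g 0 = a ∧ g p = b ∧ ∀ i < p, R (g i) (g (i + 1)) := by
  induction h with
  | refl => exact ⟨fun _ => a, 0, rfl, rfl, by simp⟩
  | @tail b c _ h2 ih =>
    obtain ⟨g, p, h0, hp, hg⟩ := ih
    refine ⟨fun i => if i ≤ p then g i else c, p + 1, by simp [h0], by simp, fun i hi => ?_⟩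
    rcases Nat.lt_succ_iff_lt_or_eq.1 hi with hi | rfl
    · simpa [show i ≤ p by omega, show i + 1 ≤ p by omega] using hg i hi
    · simpa [hp] using h2

/-- A lasso: the path to `a`, then the cycle at `a` read modulo its length `m + 1`. Splitting off
the first edge of the cycle makes this length positive. -/
theorem exists_infinite_path {α : Type*} {R : α → α → Prop} {x a : α}
    (h1 : Relation.ReflTransGen R x a) (h2 : Relation.TransGen R a a) :
    ∃ g : ℕ → α, g 0 = x ∧ (∀ i, R (g i) (g (i + 1))) ∧ ∀ t, ∃ t' ≥ t, g t' = a := by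
  obtain ⟨q, p, hq0, hqp, hq⟩ := exists_path h1
  obtain ⟨b, hab, hba⟩ := Relation.TransGen.head'_iff.1 h2
  obtain ⟨c, m, hc0, hcm, hc⟩ := exists_path hba
  have cyc : ∃ d : ℕ → α, d 0 = a ∧ d (m + 1) = a ∧ ∀ i < m + 1, R (d i) (d (i + 1)) := by
    refine ⟨fun i => Nat.casesOn i a c, rfl, hcm, fun i hi => ?_⟩
    cases i with
    | zero => simpa [hc0] using hab
    | succ i => exact hc i (by omega)
  obtain ⟨d, hd0, hdm, hd⟩ := cyc
  refine ⟨fun i => if i < p then q i else d ((i - p) % (m + 1)), ?_, fun i => ?_, fun t => ?_⟩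
  · by_cases hp : 0 < p
    · simp [hp, hq0]
    · obtain rfl : p = 0 := by omega
      simp [hd0, ← hq0, hqp]
  · dsimp only
    by_cases hi : i + 1 < p
    · rw [if_pos (by omega), if_pos hi]
      exact hq i (by omega)
    by_cases hi' : i < p
    · rw [if_pos hi', if_neg hi, show i + 1 - p = 0 by omega, Nat.zero_mod, hd0, ← hqp,
        show p = i + 1 by omega]
      exact hq i hi'
    · rw [if_neg hi', if_neg hi, show i + 1 - p = (i - p) + 1 by omega]
      have hlt : (i - p) % (m + 1) < m + 1 := Nat.mod_lt _ (by omega)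
      have := hd _ hlt
      rw [Nat.add_mod]
      rcases Nat.lt_succ_iff_lt_or_eq.1 hlt with h | h
      · have hm : (i - p) % (m + 1) + 1 % (m + 1) = (i - p) % (m + 1) + 1 := by
          rw [Nat.mod_eq_of_lt (show 1 < m + 1 by omega)]
        rw [hm, Nat.mod_eq_of_lt (show (i - p) % (m + 1) + 1 < m + 1 by omega)]
        exact this
      · rw [Nat.add_mod_mod, h, Nat.mod_self, hd0, ← hdm]
        rwa [h] at this
  · refine ⟨p + t * (m + 1), ?_, by simp [hd0]⟩
    have : t * 1 ≤ t * (m + 1) := Nat.mul_le_mul_left _ (by omega)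
    omega

/-- One step of an exact run: labels with counter values. -/
structure FStep (p : RegProg) (n : ℕ) (x y : Lab × (ℕ → ℕ)) : Prop where
  adj : Lab.Adj p x.1 y.1
  ok : ∀ c, (x.1.eff c).Ok (x.2 c)
  apply : ∀ c, y.2 c = (x.1.eff c).apply (x.2 c)
  load : y.1 = .load → y.2 1 < n
  start : x.1 = .mark ∨ x.1 = .load → y.1 ≠ .load → y.2 1 = n

/-- Counter values for the register contents `σ` and the total budget `N`. -/
def full (B N : ℕ) (σ : ℕ → ℕ) : ℕ → ℕ
  | 0 => N - ∑ r ∈ Finset.range B, σ r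
  | r + 1 => σ r

/-- The register, if any, used in the first step of a continuation is below `B`. -/
def HeadLT (B : ℕ) (s : List RegProg) : Prop := ∀ c, B < c → stEff s c = .nop

theorem sum_update_add {B r : ℕ} (hr : r < B) (σ : ℕ → ℕ) (x : ℕ) :
    (∑ i ∈ Finset.range B, Function.update σ r x i) + σ r =
      (∑ i ∈ Finset.range B, σ i) + x := by
  have h : r ∈ Finset.range B := by simpa
  rw [Finset.sum_update_of_mem h, Finset.sum_eq_add_sum_sdiff_singleton_of_mem h σ]
  omega

/-- The budget in `full` is a truncated difference, kept exact by `hx` and `hy`; the bound `hy` also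
leaves a unit to pay for an increment. `hB` places the register concerned inside the sum. -/
theorem RegProg.Step.fstep {p : RegProg} {n B N : ℕ} {x y : List RegProg × (ℕ → ℕ)} (h : Step x y)
    (hB : HeadLT B x.1) (hx : ∑ r ∈ Finset.range B, x.2 r ≤ N)
    (hy : ∑ r ∈ Finset.range B, y.2 r ≤ N) :
    FStep p n (.st x.1, full B N x.2) (.st y.1, full B N y.2) := by
  obtain ⟨s, σ⟩ := x
  obtain ⟨s', τ⟩ := y
  obtain ⟨hn, ha⟩ := h
  dsimp only at hn ha hB hx hy
  suffices key : ∀ c, (stEff s c).Ok (full B N σ c) ∧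
      full B N τ c = (stEff s c).apply (full B N σ c) from
    ⟨hn, fun c => (key c).1, fun c => (key c).2, by simp, by simp⟩
  intro c
  cases hn with
  | inc r k =>
    have hr : r < B := by
      by_contra hr
      have := hB (r + 1) (by omega)
      simp [stEff] at this
    simp only [act, Exec] at ha
    subst ha
    have := sum_update_add hr σ (σ r + 1)
    rcases c with _ | c
    · simp only [stEff, full, Eff.Ok, Eff.apply, if_true]
      omega
    · by_cases hc : c = r <;> simp [stEff, full, Eff.Ok, Eff.apply, hc]
  | dec r k =>
    have hr : r < B := by
      by_contra hr
      have := hB (r + 1) (by omega)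
      simp [stEff] at this
    simp only [act, Exec] at ha
    obtain ⟨h0, rfl⟩ := ha
    have := sum_update_add hr σ (σ r - 1)
    rcases c with _ | c
    · simp only [stEff, full, Eff.Ok, Eff.apply, if_true, true_and]
      omega
    · by_cases hc : c = r <;> simp [stEff, full, Eff.Ok, Eff.apply, hc, h0]
  | zero r k =>
    simp only [act, Exec] at ha
    obtain ⟨h0, rfl⟩ := ha
    rcases c with _ | c
    · simp [stEff, full, Eff.Ok, Eff.apply]
    · by_cases hc : c = r <;> simp [stEff, full, Eff.Ok, Eff.apply, hc, h0]
  | _ =>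
    simp only [act] at ha
    subst ha
    simp [stEff, Eff.Ok, Eff.apply]

/-- The threshold is the maximum of the register totals along the path. -/
theorem exists_budget {p q : RegProg} {n B : ℕ} (hB : ∀ s ∈ conts q [], HeadLT B s)
    {x y : List RegProg × (ℕ → ℕ)} (h : Relation.ReflTransGen Step x y)
    (hx : x.1 ∈ conts q [] ∨ x.1 = []) : (y.1 ∈ conts q [] ∨ y.1 = []) ∧
    ∃ N₀, ∀ N ≥ N₀, Relation.ReflTransGen (FStep p n)
      (.st x.1, full B N x.2) (.st y.1, full B N y.2) := by
  induction h with
  | refl => exact ⟨hx, 0, fun _ _ => .refl⟩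
  | @tail y z _ hs ih =>
    obtain ⟨hy, N₀, hN⟩ := ih
    have hy' : y.1 ∈ conts q [] := hy.resolve_right fun h => by
      have := hs.1
      rw [h] at this
      cases this
    refine ⟨conts_closed hy' hs.1, max N₀ (max (∑ r ∈ Finset.range B, y.2 r)
      (∑ r ∈ Finset.range B, z.2 r)), fun N h => (hN N ?_).tail (Step.fstep hs (hB _ hy') ?_ ?_)⟩ <;>
      simp only [ge_iff_le, max_le_iff] at h <;> omega

theorem sum_init {B : ℕ} (hB : 0 < B) (d : ℕ) :
    ∑ i ∈ Finset.range B, Function.update (0 : ℕ → ℕ) 0 d i = d := by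
  have := sum_update_add hB 0 d
  simpa using this

theorem load_path {p : RegProg} {n B N : ℕ} (hB : 0 < B) (hN : n ≤ N) :
    Relation.ReflTransGen (FStep p n) (.mark, full B N 0)
      (.st [p], full B N (Function.update (0 : ℕ → ℕ) 0 n)) := by
  have hmark : ∀ c, (Lab.mark.eff c).Ok (full B N 0 c) ∧
      full B N 0 c = (Lab.mark.eff c).apply (full B N 0 c) := by
    intro c
    rcases c with _ | c <;> simp [Lab.eff, Eff.Ok, Eff.apply, full]
  have h0 : (Function.update (0 : ℕ → ℕ) 0 0) = 0 := by simp
  have hload : ∀ d < n, ∀ c, (Lab.load.eff c).Ok (full B N (Function.update 0 0 d) c) ∧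
      full B N (Function.update 0 0 (d + 1)) c =
        (Lab.load.eff c).apply (full B N (Function.update 0 0 d) c) := by
    intro d hd c
    rcases c with _ | _ | c
    · simp only [Lab.eff, Eff.Ok, Eff.apply, full, sum_init hB, if_true]
      omega
    · simp [Lab.eff, Eff.Ok, Eff.apply, full]
    · simp [Lab.eff, Eff.Ok, Eff.apply, full]
  -- With `n = 0` there is no load, and `mark` leads straight to the program.
  rcases Nat.eq_zero_or_pos n with rfl | hn
  · refine .single ⟨Or.inr rfl, fun c => (hmark c).1, fun c => ?_, by simp, by simp [full]⟩
    rw [h0]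
    exact (hmark c).2
  · have key : ∀ d < n, Relation.ReflTransGen (FStep p n) (.mark, full B N 0)
        (.load, full B N (Function.update (0 : ℕ → ℕ) 0 d)) := by
      intro d
      induction d with
      | zero =>
        intro _
        rw [h0]
        exact .single ⟨Or.inl rfl, fun c => (hmark c).1, fun c => (hmark c).2,
          by simpa [full] using hn, by simp⟩
      | succ d ih =>
        intro hd
        exact (ih (by omega)).tail ⟨Or.inl rfl, fun c => (hload d (by omega) c).1,
          fun c => (hload d (by omega) c).2, by simpa [full] using hd, by simp⟩
    refine (key (n - 1) (by omega)).tail ⟨Or.inr rfl, fun c => (hload (n - 1) (by omega) c).1,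
      fun c => ?_, by simp, by simp [full]⟩
    have := (hload (n - 1) (by omega) c).2
    rwa [show n - 1 + 1 = n by omega] at this

theorem pre_path {p : RegProg} {n B N : ℕ} (hN : 0 < N) :
    Relation.ReflTransGen (FStep p n) (.pre, 0) (.mark, full B N 0) := by
  have hpre : ∀ j c, (Lab.pre.eff c).Ok (full B j 0 c) ∧
      full B (j + 1) 0 c = (Lab.pre.eff c).apply (full B j 0 c) := by
    intro j c
    rcases c with _ | c <;> simp [Lab.eff, Eff.Ok, Eff.apply, full]
  have key : ∀ j, Relation.ReflTransGen (FStep p n) (.pre, 0) (.pre, full B j 0) := by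
    intro j
    induction j with
    | zero =>
      have : full B 0 0 = 0 := by funext c; rcases c with _ | c <;> simp [full]
      rw [this]
    | succ j ih =>
      exact ih.tail ⟨Or.inl rfl, fun c => (hpre j c).1, fun c => (hpre j c).2, by simp, by simp⟩
  -- The last `pre` position still increments on the way to `mark`, so it is entered with budget `N
  -- - 1`.
  refine (key (N - 1)).tail ⟨Or.inr rfl, fun c => (hpre _ c).1, fun c => ?_, by simp, by simp⟩
  have := (hpre (N - 1) c).2
  rwa [show N - 1 + 1 = N by omega] at this

/-- Empty registers at the end mean that the whole budget `N` is back, so `mark` and one more round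
close a cycle. The bound `n + 1` covers the loading and makes `N` positive. -/
theorem exists_round {p : RegProg} {n B : ℕ} (hB0 : 0 < B) (hB : ∀ s ∈ conts p [], HeadLT B s)
    (h : p.Exec (Function.update (0 : ℕ → ℕ) 0 n) 0) : ∃ N,
    Relation.ReflTransGen (FStep p n) (.pre, 0) (.st [], full B N 0) ∧
    Relation.TransGen (FStep p n) (.st [], full B N 0) (.st [], full B N 0) := by
  obtain ⟨-, N₀, hN₀⟩ := exists_budget (p := p) (n := n) hB (h.steps [])
    (Or.inl (mem_conts_self p []))
  have h1 := (load_path (p := p) (n := n) (N := max N₀ (n + 1)) hB0 (by omega)).trans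
    (hN₀ (max N₀ (n + 1)) (by omega))
  have h2 : FStep p n (.st [], full B (max N₀ (n + 1)) 0) (.mark, full B (max N₀ (n + 1)) 0) :=
    ⟨rfl, fun c => trivial, fun c => rfl, by simp, by simp⟩
  exact ⟨max N₀ (n + 1), (pre_path (by omega)).trans h1, .head' h2 h1⟩

/-- An exact run with `L` positions, in which only the last position may lack a successor. -/
structure IsRun (p : RegProg) (n : ℕ) (L : ℕ∞) (g : ℕ → Lab × (ℕ → ℕ)) : Prop where
  init : g 0 = (.pre, 0)
  step : ∀ t : ℕ, ((t + 1 : ℕ) : ℕ∞) < L → FStep p n (g t) (g (t + 1))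
  last : ∀ t : ℕ, (t : ℕ∞) < L → ¬ ((t + 1 : ℕ) : ℕ∞) < L → (g t).1 = .st [] ∧
    ∀ c, c ≠ 0 → (g t).2 c = 0

theorem exists_finite_isRun {p : RegProg} {n B : ℕ} (hB0 : 0 < B)
    (hB : ∀ s ∈ conts p [], HeadLT B s) (h : p.Exec (Function.update (0 : ℕ → ℕ) 0 n) 0) :
    ∃ (L : ℕ) (g : ℕ → Lab × (ℕ → ℕ)), IsRun p n (L + 1 : ℕ) g := by
  obtain ⟨N, h1, -⟩ := exists_round hB0 hB h
  obtain ⟨g, L, h0, hL, hg⟩ := exists_path h1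
  refine ⟨L, g, h0, fun t ht => hg t ?_, fun t ht ht' => ?_⟩
  · have : t + 1 < L + 1 := by exact_mod_cast ht
    omega
  · have h2 : t < L + 1 := by exact_mod_cast ht
    have h3 : ¬ t + 1 < L + 1 := by exact_mod_cast ht'
    obtain rfl : t = L := by omega
    rw [hL]
    refine ⟨rfl, fun c hc => ?_⟩
    obtain ⟨c, rfl⟩ := Nat.exists_eq_succ_of_ne_zero hc
    rfl

theorem exists_infinite_isRun {p : RegProg} {n B : ℕ} (hB0 : 0 < B)
    (hB : ∀ s ∈ conts p [], HeadLT B s) (h : p.Exec (Function.update (0 : ℕ → ℕ) 0 n) 0) :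
    ∃ g : ℕ → Lab × (ℕ → ℕ), IsRun p n ⊤ g ∧ ∀ t, ∃ t' ≥ t, (g t').1 = .st [] := by
  obtain ⟨N, h1, h2⟩ := exists_round hB0 hB h
  obtain ⟨g, h0, hg, hrec⟩ := exists_infinite_path h1 h2
  exact ⟨g, ⟨h0, fun t _ => hg t, fun t _ ht => absurd (ENat.natCast_lt_top _) ht⟩,
    fun t => (hrec t).imp fun t' ht => ⟨ht.1, by rw [ht.2]⟩⟩

theorem IsRun.vals_eq {p : RegProg} {n : ℕ} {L : ℕ∞} {g : ℕ → Lab × (ℕ → ℕ)}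
    (h : IsRun p n L g) (c : ℕ) (t : ℕ) (ht : t < L) :
    vals (fun i => (g i).1) t c = (g t).2 c := by
  induction t with
  | zero => rw [h.init]; rfl
  | succ t ih =>
    rw [vals_succ, ih (lt_trans (by exact_mod_cast Nat.lt_succ_self t) ht),
      (h.step t ht).apply]

theorem IsRun.ok {p : RegProg} {n : ℕ} {L : ℕ∞} {g : ℕ → Lab × (ℕ → ℕ)}
    (h : IsRun p n L g) (c : ℕ) (t : ℕ) (ht : t < L) :
    ((g t).1.eff c).Ok (vals (fun i => (g i).1) t c) := by
  rw [h.vals_eq c t ht]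
  by_cases ht' : ((t + 1 : ℕ) : ℕ∞) < L
  · exact (h.step t ht').ok c
  · rw [(h.last t ht ht').1]
    simp [Lab.eff, stEff, Eff.Ok]

/-- Counter 1 counts the loads since `mark`; the conditions `load` and `start` of `FStep` tie it to
`n` and so force exactly `n` loads. -/
theorem IsRun.isControl {p : RegProg} {n : ℕ} {L : ℕ∞} {g : ℕ → Lab × (ℕ → ℕ)}
    (h : IsRun p n L g) : IsControl p n L fun i => (g i).1 := by
  refine ⟨Or.inl (by rw [h.init]), fun t ht => (h.step t ht).adj, fun i hi hm => ?_⟩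
  have hpos : ∀ t : ℕ, t < L → (g t).1 ≠ .st [] → ((t + 1 : ℕ) : ℕ∞) < L := fun t ht hne =>
    by_contra fun hcon => hne (h.last t ht hcon).1
  have hi1 := hpos i hi (by simp [hm])
  have key : ∀ d ≤ n, ((i + 1 + d : ℕ) : ℕ∞) < L ∧ (g (i + 1 + d)).2 1 = d ∧
      ((d < n ∧ (g (i + 1 + d)).1 = .load) ∨ (d = n ∧ (g (i + 1 + d)).1 = .st [p])) := by
    intro d
    induction d with
    | zero =>
      intro _
      have hs := h.step i hi1
      have hv : (g (i + 1)).2 1 = 0 := by rw [hs.apply, hm]; rfl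
      refine ⟨hi1, hv, ?_⟩
      have ha := hs.adj
      rw [hm] at ha
      rcases ha with ha | ha
      · exact Or.inl ⟨by have := hs.load ha; omega, ha⟩
      · exact Or.inr ⟨by have := hs.start (Or.inl hm) (by simp [ha]); omega, ha⟩
    | succ d ih =>
      intro hd
      obtain ⟨h1, h2, h3⟩ := ih (by omega)
      have h3 : (g (i + 1 + d)).1 = .load := by
        rcases h3 with h3 | h3
        · exact h3.2
        · omega
      have h4 := hpos _ h1 (by simp [h3])
      have hs := h.step _ h4
      have hv : (g (i + 1 + d + 1)).2 1 = d + 1 := by rw [hs.apply, h3, h2]; rfl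
      refine ⟨h4, hv, ?_⟩
      have ha := hs.adj
      rw [h3] at ha
      rcases ha with ha | ha
      · exact Or.inl ⟨by have := hs.load ha; omega, ha⟩
      · exact Or.inr ⟨by have := hs.start (Or.inr h3) (by simp [ha]); omega, ha⟩
  refine ⟨(key n le_rfl).1, fun d hd => ?_, ?_⟩
  · rcases (key d hd.le).2.2 with h | h
    · exact h.2
    · omega
  · rcases (key n le_rfl).2.2 with h | h
    · omega
    · exact h.2

/-! ### The attributes of a counter -/

/-- The tree order in which attribute `c + k` lies above attribute `c`, for `c < k`. -/
def attrLE (k : ℕ) (a b : Fin (k + k)) : Bool := decide (a = b ∨ a.val + k = b.val)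

theorem attrLE_isTreeOrder (k : ℕ) : IsTreeOrder fun a b => attrLE k a b = true where
  refl a := by simp [attrLE]
  antisymm a b h1 h2 := by
    simp only [attrLE, decide_eq_true_eq, Fin.ext_iff] at *
    omega
  trans a b c h1 h2 := by
    simp only [attrLE, decide_eq_true_eq, Fin.ext_iff] at *
    omega
  chain a b c h1 h2 := by
    simp only [attrLE, decide_eq_true_eq, Fin.ext_iff] at *
    omega

/-- A finite chain has only one increasing enumeration, so exhibiting one determines the vector. -/
theorem Valuation.hasVector_iff {A Δ : Type*} {le : A → A → Prop} (hle : IsTreeOrder le)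
    (d : Valuation le Δ) (xs : List {y : A // le y d.top})
    (hs : xs.Pairwise fun a b => le a.1 b.1 ∧ a ≠ b) (hm : ∀ a, a ∈ xs) (v : List Δ) :
    d.HasVector v ↔ v = xs.map d.val := by
  constructor
  · rintro ⟨ys, hys, hmy, rfl⟩
    have hp : ys.Perm xs := (List.perm_ext_iff_of_nodup (hys.imp And.right) (hs.imp And.right)).2
      fun a => by simp [hm, hmy]
    rw [hp.eq_of_pairwise (fun a b _ _ h1 h2 => Subtype.ext (hle.antisymm _ _ h1.1 h2.1)) hys hs]
  · rintro rfl
    exact ⟨xs, hs, hm, rfl⟩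

section Word

variable {AP Δ : Type*} {k : ℕ} (w : DataWord AP (Fin (k + k)) Δ)

/-- The data value at position `i` that names the current segment of counter `c`. -/
def segVal (i : ℕ) (c : Fin k) : Δ := w.data i (Fin.castAdd k c)

/-- The data value at position `i` that names a unit of counter `c`. -/
def unitVal (i : ℕ) (c : Fin k) : Δ := w.data i (Fin.natAdd k c)

theorem hasVector_seg (i : ℕ) (c : Fin k) (v : List Δ) :
    (w.restrict (fun a b => attrLE k a b = true) i (Fin.castAdd k c)).HasVector v ↔
      v = [segVal w i c] := by
  refine (Valuation.hasVector_iff (attrLE_isTreeOrder k) _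
    [⟨Fin.castAdd k c, (attrLE_isTreeOrder k).refl _⟩] (List.pairwise_singleton _ _) ?_ v)
  rintro ⟨a, ha⟩
  simp only [DataWord.restrict, attrLE, decide_eq_true_eq, Fin.ext_iff, Fin.val_castAdd] at ha
  exact List.mem_singleton.2 (Subtype.ext (Fin.ext (show a.val = c.val by omega)))

theorem hasVector_unit (i : ℕ) (c : Fin k) (v : List Δ) :
    (w.restrict (fun a b => attrLE k a b = true) i (Fin.natAdd k c)).HasVector v ↔
      v = [segVal w i c, unitVal w i c] := by
  have hc := c.2
  refine (Valuation.hasVector_iff (attrLE_isTreeOrder k) _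
    [⟨Fin.castAdd k c, by simp [attrLE, DataWord.restrict, Nat.add_comm]⟩,
      ⟨Fin.natAdd k c, (attrLE_isTreeOrder k).refl _⟩] ?_ ?_ v)
  · refine List.pairwise_pair.2 ⟨by simp [attrLE, Nat.add_comm], fun h => ?_⟩
    have h2 : c.val = k + c.val := congrArg (fun x => x.1.val) h
    omega
  · rintro ⟨a, ha⟩
    simp only [DataWord.restrict, attrLE, decide_eq_true_eq, Fin.ext_iff, Fin.val_natAdd] at ha
    rcases ha with ha | ha
    · exact List.mem_cons_of_mem _ (List.mem_singleton.2
        (Subtype.ext (Fin.ext (show a.val = k + c.val by omega))))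
    · exact List.mem_cons.2 (Or.inl (Subtype.ext (Fin.ext (show a.val = c.val by omega))))

theorem equiv_seg_seg (i j : ℕ) (c c' : Fin k) :
    (w.restrict (fun a b => attrLE k a b = true) i (Fin.castAdd k c)).Equiv
      (w.restrict (fun a b => attrLE k a b = true) j (Fin.castAdd k c')) ↔
      segVal w i c = segVal w j c' := by
  simp only [Valuation.Equiv, hasVector_seg, exists_eq_left]
  simp

/-- Vectors of lengths 1 and 2 differ, so classes of segments and classes of units never interfere.
-/
theorem equiv_seg_unit (i j : ℕ) (c c' : Fin k) :
    ¬ (w.restrict (fun a b => attrLE k a b = true) i (Fin.castAdd k c)).Equiv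
      (w.restrict (fun a b => attrLE k a b = true) j (Fin.natAdd k c')) := by
  simp only [Valuation.Equiv, hasVector_seg, hasVector_unit, exists_eq_left]
  simp

theorem equiv_unit_seg (i j : ℕ) (c c' : Fin k) :
    ¬ (w.restrict (fun a b => attrLE k a b = true) i (Fin.natAdd k c)).Equiv
      (w.restrict (fun a b => attrLE k a b = true) j (Fin.castAdd k c')) := by
  simp only [Valuation.Equiv, hasVector_seg, hasVector_unit, exists_eq_left]
  simp

theorem equiv_unit_unit (i j : ℕ) (c c' : Fin k) :
    (w.restrict (fun a b => attrLE k a b = true) i (Fin.natAdd k c)).Equiv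
      (w.restrict (fun a b => attrLE k a b = true) j (Fin.natAdd k c')) ↔
      segVal w i c = segVal w j c' ∧ unitVal w i c = unitVal w j c' := by
  simp only [Valuation.Equiv, hasVector_unit, exists_eq_left]
  simp

theorem exists_fin_add {P : Fin (k + k) → Prop} :
    (∃ a, P a) ↔ (∃ c, P (Fin.castAdd k c)) ∨ ∃ c, P (Fin.natAdd k c) := by
  constructor
  · rintro ⟨a, ha⟩
    induction a using Fin.addCases with
    | left c => exact Or.inl ⟨c, ha⟩
    | right c => exact Or.inr ⟨c, ha⟩
  · rintro (⟨c, h⟩ | ⟨c, h⟩) <;> exact ⟨_, h⟩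

theorem mem_classPos_seg (i j : ℕ) (c : Fin k) :
    j ∈ w.classPos (w.restrict (fun a b => attrLE k a b = true) i (Fin.castAdd k c)) ↔
      w.IsPos j ∧ ∃ c', segVal w i c = segVal w j c' := by
  simp only [DataWord.classPos, Set.mem_ofPred_eq, exists_fin_add, equiv_seg_seg, equiv_seg_unit,
    exists_false, or_false]

theorem mem_classPos_unit (i j : ℕ) (c : Fin k) :
    j ∈ w.classPos (w.restrict (fun a b => attrLE k a b = true) i (Fin.natAdd k c)) ↔
      w.IsPos j ∧ ∃ c', segVal w i c = segVal w j c' ∧ unitVal w i c = unitVal w j c' := by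
  simp only [DataWord.classPos, Set.mem_ofPred_eq, exists_fin_add, equiv_unit_unit, equiv_unit_seg,
    exists_false, false_or]

end Word

theorem DataWord.IsPos.of_le {AP A Δ : Type*} {w : DataWord AP A Δ} {i j : ℕ} (h : w.IsPos j)
    (hij : i ≤ j) : w.IsPos i := lt_of_le_of_lt (by exact_mod_cast hij) h

/-! ### Derived operators -/

namespace PosFormula

section

variable {m : ℕ} {A : Type*} {Δ : Type*} {le : A → A → Prop} {w : DataWord (Fin m) A Δ} {i : ℕ}

/-- Disjunction. -/
def or (φ ψ : PosFormula (Fin m) A) : PosFormula (Fin m) A := .neg (.and (.neg φ) (.neg ψ))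

/-- Implication. -/
def imp (φ ψ : PosFormula (Fin m) A) : PosFormula (Fin m) A := .neg (.and φ (.neg ψ))

theorem holds_or (φ ψ : PosFormula (Fin m) A) :
    (or φ ψ).Holds le w i ↔ φ.Holds le w i ∨ ψ.Holds le w i := by
  simp only [or, Holds]; tauto

theorem holds_imp (φ ψ : PosFormula (Fin m) A) :
    (imp φ ψ).Holds le w i ↔ (φ.Holds le w i → ψ.Holds le w i) := by
  simp only [imp, Holds]; tauto

theorem isMinus_or {φ ψ : PosFormula (Fin m) A} :
    (or φ ψ).IsMinus ↔ φ.IsMinus ∧ ψ.IsMinus := by simp [or, IsMinus]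

theorem isMinus_imp {φ ψ : PosFormula (Fin m) A} :
    (imp φ ψ).IsMinus ↔ φ.IsMinus ∧ ψ.IsMinus := by simp [imp, IsMinus]

variable [NeZero m]

/-- Falsity. -/
def ff : PosFormula (Fin m) A := .and (.atom 0) (.neg (.atom 0))

/-- Truth. -/
def tt : PosFormula (Fin m) A := .neg ff

/-- The formula holds at some future position. -/
def fut (φ : PosFormula (Fin m) A) : PosFormula (Fin m) A := .U tt φ

/-- The formula holds at all future positions. -/
def glob (φ : PosFormula (Fin m) A) : PosFormula (Fin m) A := .neg (fut (.neg φ))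

/-- Conjunction of a list. -/
def conj : List (PosFormula (Fin m) A) → PosFormula (Fin m) A
  | [] => tt
  | φ :: l => .and φ (conj l)

/-- Disjunction of a list of propositions. -/
def disj : List (Fin m) → PosFormula (Fin m) A
  | [] => ff
  | p :: l => or (.atom p) (disj l)

open Classical in
/-- Some proposition from `S` holds. -/
noncomputable def isIn (S : Fin m → Prop) : PosFormula (Fin m) A :=
  disj ((List.finRange m).filter fun p => decide (S p))

theorem holds_tt : (tt : PosFormula (Fin m) A).Holds le w i := by
  simp [tt, ff, Holds]

theorem holds_fut (φ : PosFormula (Fin m) A) :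
    (fut φ).Holds le w i ↔ ∃ j, w.IsPos j ∧ i ≤ j ∧ φ.Holds le w j := by
  simp only [fut, Holds, holds_tt, implies_true, and_true]

theorem holds_glob (φ : PosFormula (Fin m) A) :
    (glob φ).Holds le w 0 ↔ ∀ j, w.IsPos j → φ.Holds le w j := by
  simp only [glob, Holds, holds_fut, Nat.zero_le, true_and]
  push Not
  rfl

theorem holds_conj (l : List (PosFormula (Fin m) A)) :
    (conj l).Holds le w i ↔ ∀ φ ∈ l, φ.Holds le w i := by
  induction l with
  | nil => simp [conj, holds_tt]
  | cons φ l ih => simp [conj, Holds, ih]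

theorem holds_isIn (S : Fin m → Prop) :
    (isIn S : PosFormula (Fin m) A).Holds le w i ↔ ∃ p, S p ∧ p ∈ w.letter i := by
  have : ∀ l : List (Fin m), (disj l : PosFormula (Fin m) A).Holds le w i ↔
      ∃ p ∈ l, p ∈ w.letter i := by
    intro l
    induction l with
    | nil => simp [disj, ff, Holds]
    | cons p l ih => simp [disj, Holds, holds_or, ih]
  rw [isIn, this]
  simp

theorem isMinus_tt : (tt : PosFormula (Fin m) A).IsMinus := by simp [tt, ff, IsMinus]

theorem isMinus_fut {φ : PosFormula (Fin m) A} : (fut φ).IsMinus ↔ φ.IsMinus := by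
  simp [fut, IsMinus, isMinus_tt]

theorem isMinus_glob {φ : PosFormula (Fin m) A} : (glob φ).IsMinus ↔ φ.IsMinus := by
  simp [glob, IsMinus, isMinus_fut]

theorem isMinus_conj {l : List (PosFormula (Fin m) A)} :
    (conj l).IsMinus ↔ ∀ φ ∈ l, φ.IsMinus := by
  induction l with
  | nil => simp [conj, isMinus_tt]
  | cons φ l ih => simp [conj, IsMinus, ih]

theorem isMinus_isIn (S : Fin m → Prop) : (isIn S : PosFormula (Fin m) A).IsMinus := by
  have : ∀ l : List (Fin m), (disj l : PosFormula (Fin m) A).IsMinus := by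
    intro l
    induction l with
    | nil => simp [disj, ff, IsMinus]
    | cons p l ih => simp [disj, IsMinus, isMinus_or, ih]
  exact this _

end

/-! ### The formulae for a counter -/

section

variable {m : ℕ} [NeZero m] {k : ℕ}

/-- Without a zero test, the segment stays the same. -/
noncomputable def keepSeg (Z : Fin m → Prop) (c : Fin k) : PosFormula (Fin m) (Fin (k + k)) :=
  glob (imp (.Y tt) (or (isIn Z) (.C (Fin.castAdd k c) (-1) (.same (Fin.castAdd k c)))))

/-- A zero test starts a segment that did not occur before. -/
noncomputable def freshSeg (Z : Fin m → Prop) (c : Fin k) : PosFormula (Fin m) (Fin (k + k)) :=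
  glob (imp (isIn Z) (.C (Fin.castAdd k c) 0 (.neg (.Yc (.ofPos tt)))))

/-- The unit used by a decrement was produced by an increment in the same segment. -/
noncomputable def decInc (D I : Fin m → Prop) (c : Fin k) : PosFormula (Fin m) (Fin (k + k)) :=
  glob (imp (isIn D) (.C (Fin.natAdd k c) 0
    (.Yc (.and (.ofPos (isIn I)) (.same (Fin.natAdd k c))))))

/-- The unit produced by an increment is used by a decrement in the same segment. -/
noncomputable def incDec (D I : Fin m → Prop) (c : Fin k) : PosFormula (Fin m) (Fin (k + k)) :=
  glob (imp (isIn I) (.C (Fin.natAdd k c) 0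
    (.Xc (.and (.ofPos (isIn D)) (.same (Fin.natAdd k c))))))

variable {Δ : Type*} {w : DataWord (Fin m) (Fin (k + k)) Δ} {lam : ℕ → Fin m}

theorem holds_isIn_of_letter {S : Fin m → Prop} {A : Type*} {le : A → A → Prop}
    {w : DataWord (Fin m) A Δ} {i : ℕ} {q : Fin m} (h : ∀ p, p ∈ w.letter i ↔ p = q) :
    (isIn S : PosFormula (Fin m) A).Holds le w i ↔ S q := by
  simp [holds_isIn, h]

variable (hl : ∀ i, w.IsPos i → ∀ p, p ∈ w.letter i ↔ p = lam i)

include hl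

theorem holds_keepSeg (Z : Fin m → Prop) (c : Fin k) :
    (keepSeg Z c).Holds (fun a b => attrLE k a b = true) w 0 ↔
      ∀ i, w.IsPos (i + 1) → Z (lam (i + 1)) ∨ segVal w i c = segVal w (i + 1) c := by
  rw [keepSeg, holds_glob]
  constructor
  · intro h i hi
    have := h (i + 1) hi
    rw [holds_imp, holds_or, holds_isIn_of_letter (hl _ hi)] at this
    simp only [Holds, ClassFormula.Holds] at this
    refine (this ⟨i, rfl, holds_tt⟩).imp_right ?_
    rintro ⟨j, hj, -, hj'⟩
    obtain rfl : j = i := by omega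
    exact (equiv_seg_seg w _ _ _ _).1 hj'
  · intro h i hi
    rw [holds_imp, holds_or, holds_isIn_of_letter (hl _ hi)]
    simp only [Holds, ClassFormula.Holds]
    rintro ⟨j, rfl, -⟩
    refine (h j hi).imp_right fun h' => ⟨j, by omega, hi.of_le (by omega), ?_⟩
    exact (equiv_seg_seg w _ _ _ _).2 h'

theorem holds_freshSeg (Z : Fin m → Prop) (c : Fin k) :
    (freshSeg Z c).Holds (fun a b => attrLE k a b = true) w 0 ↔
      ∀ i, w.IsPos i → Z (lam i) → ∀ j < i, ∀ c', segVal w i c ≠ segVal w j c' := by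
  rw [freshSeg, holds_glob]
  refine forall₂_congr fun i hi => ?_
  rw [holds_imp, holds_isIn_of_letter (hl _ hi)]
  simp only [Holds, ClassFormula.Holds]
  refine imp_congr_right fun _ => ?_
  constructor
  · rintro ⟨i', hi', -, h⟩ j hj c' he
    obtain rfl : i' = i := by omega
    refine h ?_
    classical
    -- `Yc` refers to the nearest earlier class position, which exists because only finitely many
    -- positions precede `i'`.
    obtain ⟨l, ⟨hl1, hl2⟩, hl3⟩ := ((Set.finite_Iio i').subset fun x hx => hx.2 :
      {x | x ∈ w.classPos (w.restrict (fun a b => attrLE k a b = true) i' (Fin.castAdd k c)) ∧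
        x < i'}.Finite).exists_maximal ⟨j, (mem_classPos_seg w _ _ _).2
          ⟨hi.of_le hj.le, c', he⟩, hj⟩
    refine ⟨l, hl1, hl2, fun x hx hxi => ?_, holds_tt⟩
    by_contra hcon
    exact hcon (hl3 ⟨hx, hxi⟩ (by omega))
  · intro h
    refine ⟨i, by omega, hi, ?_⟩
    rintro ⟨j, hj, hji, -, -⟩
    obtain ⟨-, c', he⟩ := (mem_classPos_seg w _ _ _).1 hj
    exact h j hji c' he

theorem holds_decInc (D I : Fin m → Prop) (c : Fin k) :
    (decInc D I c).Holds (fun a b => attrLE k a b = true) w 0 ↔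
      ∀ i, w.IsPos i → D (lam i) → ∃ j < i, I (lam j) ∧
        (segVal w i c = segVal w j c ∧ unitVal w i c = unitVal w j c) ∧
        ∀ l, j < l → l < i → ∀ c',
          ¬ (segVal w i c = segVal w l c' ∧ unitVal w i c = unitVal w l c') := by
  rw [decInc, holds_glob]
  refine forall₂_congr fun i hi => ?_
  rw [holds_imp, holds_isIn_of_letter (hl _ hi)]
  simp only [Holds, ClassFormula.Holds]
  refine imp_congr_right fun _ => ?_
  constructor
  · rintro ⟨i', hi', -, j, hj, hji, hmax, h1, h2⟩
    obtain rfl : i' = i := by omega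
    have hjp := hi.of_le hji.le
    obtain ⟨h3, h4⟩ := (equiv_unit_unit w _ _ _ _).1 h2
    refine ⟨j, hji, (holds_isIn_of_letter (hl _ hjp)).1 h1, ⟨h3.symm, h4.symm⟩,
      fun l hjl hli c' he => ?_⟩
    have := hmax l ((mem_classPos_unit w _ _ _).2 ⟨hi.of_le hli.le, c', he⟩) hli
    omega
  · rintro ⟨j, hji, h1, h2, h3⟩
    have hjp := hi.of_le hji.le
    refine ⟨i, by omega, hi, j, (mem_classPos_unit w _ _ _).2 ⟨hjp, c, h2⟩, hji,
      fun l hl hli => ?_, (holds_isIn_of_letter (hl _ hjp)).2 h1,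
      (equiv_unit_unit w _ _ _ _).2 ⟨h2.1.symm, h2.2.symm⟩⟩
    by_contra hcon
    obtain ⟨-, c', he⟩ := (mem_classPos_unit w _ _ _).1 hl
    exact h3 l (by omega) hli c' he

theorem holds_incDec (D I : Fin m → Prop) (c : Fin k) :
    (incDec D I c).Holds (fun a b => attrLE k a b = true) w 0 ↔
      ∀ i, w.IsPos i → I (lam i) → ∃ j, i < j ∧ w.IsPos j ∧ D (lam j) ∧
        (segVal w i c = segVal w j c ∧ unitVal w i c = unitVal w j c) ∧
        ∀ l, i < l → l < j → ∀ c',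
          ¬ (segVal w i c = segVal w l c' ∧ unitVal w i c = unitVal w l c') := by
  rw [incDec, holds_glob]
  refine forall₂_congr fun i hi => ?_
  rw [holds_imp, holds_isIn_of_letter (hl _ hi)]
  simp only [Holds, ClassFormula.Holds]
  refine imp_congr_right fun _ => ?_
  constructor
  · rintro ⟨i', hi', -, j, hj, hji, hmin, h1, h2⟩
    obtain rfl : i' = i := by omega
    have hjp := ((mem_classPos_unit w _ _ _).1 hj).1
    obtain ⟨h3, h4⟩ := (equiv_unit_unit w _ _ _ _).1 h2
    refine ⟨j, hji, hjp, (holds_isIn_of_letter (hl _ hjp)).1 h1, ⟨h3.symm, h4.symm⟩,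
      fun l hjl hli c' he => ?_⟩
    have := hmin l ((mem_classPos_unit w _ _ _).2 ⟨hjp.of_le hli.le, c', he⟩) hjl
    omega
  · rintro ⟨j, hji, hjp, h1, h2, h3⟩
    refine ⟨i, by omega, hi, j, (mem_classPos_unit w _ _ _).2 ⟨hjp, c, h2⟩, hji,
      fun l hl hli => ?_, (holds_isIn_of_letter (hl _ hjp)).2 h1,
      (equiv_unit_unit w _ _ _ _).2 ⟨h2.1.symm, h2.2.symm⟩⟩
    by_contra hcon
    obtain ⟨-, c', he⟩ := (mem_classPos_unit w _ _ _).1 hl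
    exact h3 l hli (by omega) c' he

end

end PosFormula

/-! ### From data values to matchings and back -/

/-- The data values `s` name the segments between zero tests of counter `c`, and the data values
`u` link every decrement to an increment. -/
structure IsLinked {k : ℕ} {Δ : Type*} (L : ℕ∞) (e : ℕ → Eff) (s u : ℕ → Fin k → Δ)
    (c : Fin k) : Prop where
  keep : ∀ i : ℕ, ((i + 1 : ℕ) : ℕ∞) < L → e (i + 1) = .zero ∨ s i c = s (i + 1) c
  fresh : ∀ i : ℕ, (i : ℕ∞) < L → e i = .zero → ∀ j < i, ∀ c', s i c ≠ s j c'
  back : ∀ i : ℕ, (i : ℕ∞) < L → e i = .dec → ∃ j < i, e j = .inc ∧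
    (s i c = s j c ∧ u i c = u j c) ∧
    ∀ l, j < l → l < i → ∀ c', ¬ (s i c = s l c' ∧ u i c = u l c')

/-- The data values `u` link every increment to a decrement. -/
def IsForwardLinked {k : ℕ} {Δ : Type*} (L : ℕ∞) (e : ℕ → Eff) (s u : ℕ → Fin k → Δ)
    (c : Fin k) : Prop :=
  ∀ i : ℕ, (i : ℕ∞) < L → e i = .inc → ∃ j : ℕ, i < j ∧ (j : ℕ∞) < L ∧ e j = .dec ∧
    (s i c = s j c ∧ u i c = u j c) ∧
    ∀ l, i < l → l < j → ∀ c', ¬ (s i c = s l c' ∧ u i c = u l c')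

section

variable {k : ℕ} {Δ : Type*} {L : ℕ∞} {e : ℕ → Eff} {s u : ℕ → Fin k → Δ} {c : Fin k}

theorem natCast_lt_of_le {i j : ℕ} (h : (j : ℕ∞) < L) (hij : i ≤ j) : (i : ℕ∞) < L :=
  lt_of_le_of_lt (by exact_mod_cast hij) h

/-- After a zero test the segment value is copied or replaced by a fresh one, so it never returns to
a value from before the test. -/
theorem IsLinked.no_zero (h : IsLinked L e s u c) {i j : ℕ} (hj : (j : ℕ∞) < L)
    (hs : s j c = s i c) : ∀ z, i < z → z ≤ j → e z ≠ .zero := by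
  intro z hiz hzj hz
  have key : ∀ l, z ≤ l → (l : ℕ∞) < L → s l c ≠ s i c := by
    intro l hzl
    induction l, hzl using Nat.le_induction with
    | base => exact fun hl => h.fresh z hl hz i hiz c
    | succ l hzl ih =>
      intro hl
      rcases h.keep l hl with h1 | h1
      · exact h.fresh _ hl h1 i (by omega) c
      · rw [← h1]
        exact ih (natCast_lt_of_le hl (by omega))
  exact key j hzj hj hs

/-- `m t` is the previous position of the class of `t`. If `t < t'` had the same one, `t` would lie
in the class between `m t'` and `t'`. With forward links, the next class position `j` of an
increment `i` has `m j = i`, since either strict inequality puts a class position in a forbidden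
gap. -/
theorem IsLinked.exists_matching (h : IsLinked L e s u c) : ∃ m, Matching e L m ∧
    (IsForwardLinked L e s u c → ∀ i : ℕ, (i : ℕ∞) < L → e i = .inc →
      ∃ j : ℕ, (j : ℕ∞) < L ∧ i < j ∧ e j = .dec ∧ m j = i) := by
  choose! m hlt hinc heq hmax using h.back
  have inj : ∀ t t' : ℕ, (t' : ℕ∞) < L → t < t' → e t = .dec → e t' = .dec → m t ≠ m t' := by
    intro t t' ht' htt hd hd' hm
    have ht := natCast_lt_of_le ht' htt.le
    refine hmax t' ht' hd' t (hm ▸ hlt t ht hd) htt c ⟨?_, ?_⟩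
    · rw [(heq t' ht' hd').1, (heq t ht hd).1, hm]
    · rw [(heq t' ht' hd').2, (heq t ht hd).2, hm]
  refine ⟨m, ⟨hlt, hinc, fun t ht hd => h.no_zero ht (heq t ht hd).1, fun t t' ht ht' hd hd' hm =>
    ?_⟩, fun hf i hi hie => ?_⟩
  · rcases lt_trichotomy t t' with h1 | h1 | h1
    · exact absurd hm (inj t t' ht' h1 hd hd')
    · exact h1
    · exact absurd hm.symm (inj t' t ht h1 hd' hd)
  · obtain ⟨j, hij, hj, hd, hc, hmin⟩ := hf i hi hie
    refine ⟨j, hj, hij, hd, ?_⟩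
    have h1 : ¬ m j < i := fun hlt' => hmax j hj hd i hlt' hij c ⟨hc.1.symm, hc.2.symm⟩
    have h2 : ¬ i < m j := fun hlt' => hmin (m j) hlt' (hlt j hj hd) c
      ⟨hc.1.trans (heq j hj hd).1, hc.2.trans (heq j hj hd).2⟩
    omega

end

-- Data values for exact runs

theorem val_add_count (e : ℕ → Eff) (t : ℕ) (h : ∀ i < t, (e i).Ok (val e i)) :
    val e t + Nat.count (fun i => e i = .dec) t = Nat.count (fun i => e i = .inc) t := by
  induction t with
  | zero => simp [val]
  | succ t ih =>
    have ih := ih fun i hi => h i (by omega)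
    have ht := h t (by omega)
    rw [Nat.count_succ, Nat.count_succ, val]
    cases he : e t <;> rw [he] at ht <;> simp only [Eff.Ok] at ht <;> simp [Eff.apply] <;> omega

theorem exists_count_eq {P : ℕ → Prop} [DecidablePred P] {t q : ℕ} (h : q < Nat.count P t) :
    ∃ j < t, P j ∧ Nat.count P j = q := by
  induction t with
  | zero => simp at h
  | succ t ih =>
    by_cases hq : q < Nat.count P t
    · obtain ⟨j, hj, h1⟩ := ih hq
      exact ⟨j, by omega, h1⟩
    · rw [Nat.count_succ] at h
      by_cases hP : P t
      · rw [if_pos hP] at h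
        exact ⟨t, by omega, hP, by omega⟩
      · rw [if_neg hP] at h
        omega

theorem count_eq_of_forall_not {P : ℕ → Prop} [DecidablePred P] {a b : ℕ} (hab : a ≤ b)
    (h : ∀ z, a ≤ z → z < b → ¬ P z) : Nat.count P a = Nat.count P b := by
  induction b, hab using Nat.le_induction with
  | base => rfl
  | succ b hab ih =>
    rw [Nat.count_succ, if_neg (h b hab (by omega)), Nat.add_zero]
    exact ih fun z h1 h2 => h z h1 (by omega)

theorem count_lt_of_lt {P : ℕ → Prop} [DecidablePred P] {a b : ℕ} (hab : a < b) (h : P a) :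
    Nat.count P a < Nat.count P b := by
  have h1 : Nat.count P (a + 1) ≤ Nat.count P b := Nat.count_monotone P hab
  rw [Nat.count_succ, if_pos h] at h1
  omega

/-- A name for the segment at position `i` of the counter `c` with effects `e`. -/
def segName (e : ℕ → Eff) (c i : ℕ) : ℕ × ℕ × ℕ :=
  (0, c, Nat.count (fun i => e i = .zero) (i + 1))

/-- A name for the unit at position `i` of the counter `c` with effects `e`; units are consumed in
the order of their production. -/
def unitName (e : ℕ → Eff) (c i : ℕ) : ℕ × ℕ × ℕ :=
  match e i with
  | .inc => (1, c, Nat.count (fun i => e i = .inc) i)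
  | .dec => (1, c, Nat.count (fun i => e i = .dec) i)
  | _ => (2, c, i)

section

variable {L : ℕ∞} {e : ℕ → ℕ → Eff}

/-- First in, first out. By `val_add_count`, a decrement placed before its increment would occur at
value zero, and a zero test between the two would find the unit of `i` still unspent. In between,
increments of the same counter have larger numbers and decrements smaller ones, so the name does not
recur. -/
theorem names_of_count_eq {c : ℕ} (hok : ∀ t : ℕ, (t : ℕ∞) < L → (e c t).Ok (val (e c) t))
    {i j : ℕ} (hj : (j : ℕ∞) < L) (hi : e c i = .inc) (hd : e c j = .dec)
    (hc : Nat.count (fun i => e c i = .inc) i = Nat.count (fun i => e c i = .dec) j) :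
    i < j ∧ segName (e c) c i = segName (e c) c j ∧ unitName (e c) c i = unitName (e c) c j ∧
      ∀ l, i < l → l < j → ∀ c', unitName (e c) c i ≠ unitName (e c') c' l := by
  have hv : ∀ t ≤ j, _ := fun t ht =>
    val_add_count (e c) t fun i hi => hok i (natCast_lt_of_le hj (by omega))
  have hij : i < j := by
    by_contra hcon
    have h1 := hv j le_rfl
    have h2 := hok j hj
    rw [hd] at h2
    have h2 : 0 < val (e c) j := h2
    have h3 := Nat.count_monotone (fun i => e c i = .inc) (show j ≤ i by omega)
    omega
  have hu : unitName (e c) c i = (1, c, Nat.count (fun i => e c i = .inc) i) := by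
    simp [unitName, hi]
  refine ⟨hij, ?_, ?_, fun l hil hlj c' => ?_⟩
  · simp only [segName]
    suffices hnz : ∀ z, i + 1 ≤ z → z < j + 1 → ¬ e c z = .zero by
      rw [count_eq_of_forall_not (by omega) hnz]
    intro z h1 h2 hz
    have hzj : z ≠ j := by rintro rfl; simp [hz] at hd
    have h3 := hv z (by omega)
    have h4 := hok z (natCast_lt_of_le hj (by omega))
    rw [hz] at h4
    have h4 : val (e c) z = 0 := h4
    have h5 := count_lt_of_lt (P := fun i => e c i = .inc) (show i < z by omega) hi
    have h6 := Nat.count_monotone (fun i => e c i = .dec) (show z ≤ j by omega)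
    omega
  · rw [hu]; simp [unitName, hd, hc]
  · rw [hu]
    intro heq
    have hcc : c' = c := by
      simp only [unitName] at heq
      split at heq <;> simp at heq <;> exact heq.1.symm
    subst hcc
    simp only [unitName] at heq
    split at heq
    · rename_i h
      have := count_lt_of_lt (P := fun i => e c' i = .inc) hil hi
      simp at heq
      omega
    · rename_i h
      have := count_lt_of_lt (P := fun i => e c' i = .dec) hlj h
      simp at heq
      omega
    · simp at heq

variable {k : ℕ} {Δ : Type*} {f : ℕ × ℕ × ℕ → Δ} (hf : Function.Injective f)

include hf

theorem isLinked_names (c : Fin k)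
    (hok : ∀ t : ℕ, (t : ℕ∞) < L → (e c t).Ok (val (e c) t)) :
    IsLinked L (e c) (fun i c => f (segName (e c) c i)) (fun i c => f (unitName (e c) c i)) c where
  keep i hi := by
    by_cases hz : e c (i + 1) = .zero
    · exact Or.inl hz
    · right
      simp [segName, Nat.count_succ, hz]
  fresh i hi hz j hj c' heq := by
    have h := hf heq
    simp only [segName, Prod.mk.injEq, true_and] at h
    obtain ⟨h1, h2⟩ := h
    have hcc : c' = c := Fin.ext h1.symm
    subst hcc
    have h3 := count_lt_of_lt (P := fun i => e c' i = .zero) (Nat.lt_succ_self i) hz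
    have h4 := Nat.count_monotone (fun i => e c' i = .zero) (show j + 1 ≤ i by omega)
    simp only [Nat.succ_eq_add_one] at h3
    omega
  back i hi hd := by
    have hv := val_add_count (e c) i fun l hl => hok l (natCast_lt_of_le hi hl.le)
    have h2 := hok i hi
    rw [hd] at h2
    have h2 : 0 < val (e c) i := h2
    -- The value is positive, so more increments than decrements precede `i`, and an increment with
    -- the number of this decrement exists.
    obtain ⟨j, hji, hj, hc⟩ := exists_count_eq (P := fun i => e c i = .inc) (t := i)
      (q := Nat.count (fun i => e c i = .dec) i) (by omega)
    obtain ⟨-, h3, h4, h5⟩ := names_of_count_eq hok hi hj hd hc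
    exact ⟨j, hji, hj, ⟨by simp only [h3], by simp only [h4]⟩, fun l hjl hli c' ⟨_, h6⟩ =>
      h5 l hjl hli c' (h4.trans (hf h6))⟩

/-- Value zero at `T` means equally many increments and decrements before `T`, so each increment
number is also the number of a decrement. -/
theorem isForwardLinked_names (c : Fin k)
    (hok : ∀ t : ℕ, (t : ℕ∞) < L → (e c t).Ok (val (e c) t)) {T : ℕ} (hT : L = (T + 1 : ℕ))
    (h0 : val (e c) T = 0) (hT' : e c T = .nop) :
    IsForwardLinked L (e c) (fun i c => f (segName (e c) c i))
      (fun i c => f (unitName (e c) c i)) c := by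
  intro i hi hinc
  have hTL : (T : ℕ∞) < L := by rw [hT]; exact_mod_cast Nat.lt_succ_self T
  have hv := val_add_count (e c) T fun l hl => hok l (natCast_lt_of_le hTL hl.le)
  have hiT : i < T := by
    rw [hT] at hi
    have hi : i < T + 1 := by exact_mod_cast hi
    have : i ≠ T := by rintro rfl; simp [hT'] at hinc
    omega
  have h1 := count_lt_of_lt (P := fun i => e c i = .inc) hiT hinc
  obtain ⟨j, hj, hd, hc⟩ := exists_count_eq (P := fun i => e c i = .dec) (t := T)
      (q := Nat.count (fun i => e c i = .inc) i) (by omega)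
  have hjL := natCast_lt_of_le hTL hj.le
  obtain ⟨h2, h3, h4, h5⟩ := names_of_count_eq hok hjL hinc hd hc.symm
  exact ⟨j, h2, hjL, hd, ⟨by simp only [h3], by simp only [h4]⟩, fun l hil hlj c' ⟨_, h6⟩ =>
    h5 l hil hlj c' (hf h6)⟩

end

open PosFormula

-- Finite sets of labels

/-- The finite enumeration `lab` contains all labels of runs of `p`, and these use only
the counters up to `B`. -/
structure IsLabelling (p : RegProg) (B : ℕ) {m : ℕ} (lab : Fin m → Lab) : Prop where
  pos : 0 < B
  head : ∀ s ∈ RegProg.conts p [], HeadLT B s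
  pre : ∃ q, lab q = .pre
  closed : ∀ q x, Lab.Adj p (lab q) x → ∃ q', lab q' = x
  bound : ∀ q c, (lab q).eff c = .inc ∨ (lab q).eff c = .dec → c < B + 1

theorem exists_headLT (s : List RegProg) : ∃ B, HeadLT B s := by
  match s with
  | .inc r :: _ =>
    exact ⟨r + 1, fun c hc => by simp [stEff, show c ≠ 0 by omega, show c ≠ r + 1 by omega]⟩
  | .dec r :: _ =>
    exact ⟨r + 1, fun c hc => by simp [stEff, show c ≠ 0 by omega, show c ≠ r + 1 by omega]⟩
  | .zero r :: _ => exact ⟨r + 1, fun c hc => by simp [stEff, show c ≠ r + 1 by omega]⟩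
  | [] | .skip :: _ | .seq _ _ :: _ | .star _ :: _ => exact ⟨0, fun c _ => rfl⟩

theorem exists_labelling (p : RegProg) :
    ∃ (B m : ℕ) (_ : NeZero m) (lab : Fin m → Lab), IsLabelling p B lab := by
  choose b hb using exists_headLT
  obtain ⟨B, hB⟩ := ((RegProg.conts_finite p []).image b).bddAbove
  have hhead : ∀ s ∈ RegProg.conts p [], HeadLT (B + 1) s := fun s hs c hc =>
    hb s c (by have := hB (Set.mem_image_of_mem b hs); omega)
  -- `conts` omits the final empty stack, so the halting label is added by hand.
  set T : Set Lab := {.pre, .mark, .load} ∪ Lab.st '' (insert [] (RegProg.conts p [])) with hT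
  have hfin : T.Finite :=
    (Set.toFinite _).union (((RegProg.conts_finite p []).insert []).image _)
  obtain ⟨m, lab, -, hlab⟩ := hfin.fin_param
  have hmem : ∀ x, x ∈ T ↔ ∃ q, lab q = x := fun x => by rw [← hlab]; rfl
  have hpre : ∃ q, lab q = .pre := (hmem _).1 (by simp [hT])
  refine ⟨B + 1, m, ⟨?_⟩, lab, by omega, hhead, hpre, fun q x hx => (hmem x).1 ?_,
    fun q c hc => ?_⟩
  · rintro rfl
    exact hpre.elim fun q _ => q.elim0
  · have hq := (hmem _).2 ⟨q, rfl⟩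
    have hp : [p] ∈ RegProg.conts p [] := RegProg.mem_conts_self p []
    cases hl : lab q with
    | pre => rw [hl] at hx; rcases hx with rfl | rfl <;> simp [hT]
    | mark => rw [hl] at hx; rcases hx with rfl | rfl <;> simp [hT, hp]
    | load => rw [hl] at hx; rcases hx with rfl | rfl <;> simp [hT, hp]
    | st s =>
      rw [hl] at hx hq
      cases x with
      | pre => exact hx.elim
      | load => exact hx.elim
      | mark => simp [hT]
      | st s' =>
        have hs : s = [] ∨ s ∈ RegProg.conts p [] := by simpa [hT] using hq
        rcases hs with rfl | hs
        · cases hx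
        · rcases RegProg.conts_closed hs hx with h | h <;> simp [hT, h]
  · have hq := (hmem _).2 ⟨q, rfl⟩
    by_contra hcon
    cases hl : lab q with
    | pre => simp [hl, Lab.eff, show c ≠ 0 by omega] at hc
    | mark => simp [hl, Lab.eff, show c ≠ 0 by omega] at hc
    | load => simp [hl, Lab.eff, show c ≠ 0 by omega, show c ≠ 1 by omega] at hc
    | st s =>
      rw [hl] at hq hc
      have hs : s = [] ∨ s ∈ RegProg.conts p [] := by simpa [hT] using hq
      rcases hs with rfl | hs
      · simp [Lab.eff, stEff] at hc
      · simp [Lab.eff, hhead s hs c (by omega)] at hc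

/-! ### The formula for runs -/

section

variable (p : RegProg) {m : ℕ} [NeZero m] (lab : Fin m → Lab) (k : ℕ) {A : Type*}

/-- Every position carries exactly one proposition. -/
noncomputable def uniqueLetter : PosFormula (Fin m) A :=
  .and (glob (isIn fun _ => True))
    (conj ((List.finRange m).map fun q => glob (imp (.atom q) (.neg (isIn fun q' => q' ≠ q)))))

/-- The first label is admissible, and consecutive labels fit. -/
noncomputable def control : PosFormula (Fin m) A :=
  .and (isIn fun q => lab q = .pre ∨ lab q = .mark)
    (conj ((List.finRange m).map fun q => glob (imp (.atom q)
      (imp (.X tt) (.X (isIn fun q' => Lab.Adj p (lab q) (lab q')))))))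

/-- The data values link decrements to increments for all counters. -/
noncomputable def linked : PosFormula (Fin m) (Fin (k + k)) :=
  conj ((List.finRange k).map fun c : Fin k => conj
    [keepSeg (fun q => (lab q).eff c = .zero) c, freshSeg (fun q => (lab q).eff c = .zero) c,
      decInc (fun q => (lab q).eff c = .dec) (fun q => (lab q).eff c = .inc) c])

/-- The data values link increments to decrements for all counters except the budget. -/
noncomputable def forwardLinked : PosFormula (Fin m) (Fin (k + k)) :=
  conj (((List.finRange k).filter fun c => c.val ≠ 0).map fun c : Fin k =>
    incDec (fun q => (lab q).eff c = .dec) (fun q => (lab q).eff c = .inc) c)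

/-- The next `n` labels are loads, followed by the start of the program. -/
noncomputable def loads : ℕ → PosFormula (Fin m) A
  | 0 => .X (isIn fun q => lab q = .st [p])
  | n + 1 => .X (.and (isIn fun q => lab q = .load) (loads n))

/-- Every round loads the number `n`. -/
noncomputable def rounds (n : ℕ) : PosFormula (Fin m) A :=
  glob (imp (isIn fun q => lab q = .mark) (loads p lab n))

/-- The formula for finite runs. -/
noncomputable def finFormula (n : ℕ) : PosFormula (Fin m) (Fin (k + k)) :=
  .and (conj [uniqueLetter, control p lab, linked lab k, forwardLinked lab k,
    glob (or (.X tt) (isIn fun q => lab q = .st []))]) (rounds p lab n)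

/-- The formula for infinite runs. -/
noncomputable def infFormula (n : ℕ) : PosFormula (Fin m) (Fin (k + k)) :=
  .and (conj [uniqueLetter, control p lab, linked lab k,
    glob (fut (isIn fun q => lab q = .st []))]) (rounds p lab n)

/-- Among the counter formulae only `incDec` uses a future class operator, and it enters
`finFormula` alone. -/
theorem isMinus_infFormula (n : ℕ) : (infFormula p lab k n).IsMinus := by
  have hload : ∀ n, (loads p lab n : PosFormula (Fin m) (Fin (k + k))).IsMinus := by
    intro n
    induction n with
    | zero => simp [loads, IsMinus, isMinus_isIn]
    | succ n ih => simp [loads, IsMinus, isMinus_isIn, ih]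
  simp [infFormula, IsMinus, isMinus_conj, uniqueLetter, control, linked, rounds, keepSeg,
    freshSeg, decInc, isMinus_glob, isMinus_imp, isMinus_or, isMinus_fut, isMinus_isIn,
    isMinus_tt, ClassFormula.IsMinus, hload]

variable {p lab k} {Δ : Type*} {le : A → A → Prop} {w : DataWord (Fin m) A Δ} {lam : ℕ → Fin m}

theorem exists_lam_of_uniqueLetter (h : uniqueLetter.Holds le w 0) :
    ∃ lam : ℕ → Fin m, ∀ i, w.IsPos i → ∀ q, q ∈ w.letter i ↔ q = lam i := by
  obtain ⟨h1, h2⟩ : (_ ∧ _) := by simpa only [uniqueLetter, Holds] using h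
  rw [holds_glob] at h1
  simp only [holds_isIn, true_and] at h1
  choose! lam hlam using h1
  refine ⟨lam, fun i hi q => ⟨fun hq => ?_, fun hq => hq ▸ hlam i hi⟩⟩
  have h3 := (holds_conj _).1 h2 _ (List.mem_map_of_mem (List.mem_finRange q))
  have h4 := (holds_imp _ _).1 ((holds_glob _).1 h3 i hi) (by simpa only [Holds] using hq)
  simp only [Holds, holds_isIn, not_exists, not_and] at h4
  by_contra hne
  exact h4 (lam i) (fun h => hne h.symm) (hlam i hi)

variable (hl : ∀ i, w.IsPos i → ∀ q, q ∈ w.letter i ↔ q = lam i)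

include hl

theorem holds_uniqueLetter : uniqueLetter.Holds le w 0 := by
  simp only [uniqueLetter, Holds, holds_glob, holds_conj, List.mem_map, List.mem_finRange,
    true_and, forall_exists_index, forall_apply_eq_imp_iff]
  refine ⟨fun i hi => (holds_isIn_of_letter (hl i hi)).2 trivial, fun q i hi => ?_⟩
  rw [holds_imp]
  simp only [Holds, holds_isIn_of_letter (hl i hi)]
  exact fun h => not_not.2 ((hl i hi q).1 h).symm

theorem holds_control (h0 : w.IsPos 0) : (control p lab).Holds le w 0 ↔
    (lab (lam 0) = .pre ∨ lab (lam 0) = .mark) ∧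
      ∀ t, w.IsPos (t + 1) → Lab.Adj p (lab (lam t)) (lab (lam (t + 1))) := by
  simp only [control, Holds, holds_glob, holds_conj, List.mem_map, List.mem_finRange,
    true_and, forall_exists_index, forall_apply_eq_imp_iff, holds_isIn_of_letter (hl 0 h0)]
  refine and_congr_right fun _ => ?_
  constructor
  · intro h t ht
    have ht' : w.IsPos t := ht.of_le (by omega)
    have := h (lam t) t ht'
    rw [holds_imp, holds_imp] at this
    simp only [Holds] at this
    exact (holds_isIn_of_letter (hl _ ht)).1 (this ((hl t ht' _).2 rfl) ⟨ht, holds_tt⟩).2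
  · intro h q t ht
    rw [holds_imp, holds_imp]
    simp only [Holds]
    rintro hq ⟨ht', -⟩
    refine ⟨ht', (holds_isIn_of_letter (hl _ ht')).2 ?_⟩
    rw [(hl t ht q).1 hq]
    exact h t ht'

theorem holds_loads (n i : ℕ) : (loads p lab n).Holds le w i ↔
    w.IsPos (i + 1 + n) ∧ (∀ d < n, lab (lam (i + 1 + d)) = .load) ∧
      lab (lam (i + 1 + n)) = .st [p] := by
  induction n generalizing i with
  | zero =>
    simp only [loads, Holds, Nat.not_lt_zero, false_implies, implies_true, true_and, Nat.add_zero]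
    exact and_congr_right fun h => holds_isIn_of_letter (hl _ h)
  | succ n ih =>
    simp only [loads, Holds, ih]
    rw [show i + 1 + 1 + n = i + 1 + (n + 1) by omega]
    constructor
    · rintro ⟨h1, h2, h3, h4, h5⟩
      refine ⟨h3, fun d hd => ?_, h5⟩
      rcases d with _ | d
      · exact (holds_isIn_of_letter (hl _ h1)).1 h2
      · have := h4 d (by omega)
        rwa [show i + 1 + 1 + d = i + 1 + (d + 1) by omega] at this
    · rintro ⟨h3, h4, h5⟩
      have h1 : w.IsPos (i + 1) := h3.of_le (by omega)
      refine ⟨h1, (holds_isIn_of_letter (hl _ h1)).2 (h4 0 (by omega)), h3, fun d hd => ?_, h5⟩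
      have := h4 (d + 1) (by omega)
      rwa [show i + 1 + (d + 1) = i + 1 + 1 + d by omega] at this

theorem holds_rounds (n : ℕ) : (rounds p lab n).Holds le w 0 ↔
    ∀ i, w.IsPos i → lab (lam i) = .mark → w.IsPos (i + 1 + n) ∧
      (∀ d < n, lab (lam (i + 1 + d)) = .load) ∧ lab (lam (i + 1 + n)) = .st [p] := by
  rw [rounds, holds_glob]
  refine forall₂_congr fun i hi => ?_
  rw [holds_imp, holds_isIn_of_letter (hl i hi), holds_loads hl]

theorem isControl_iff (h0 : w.IsPos 0) (n : ℕ) :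
    (control p lab).Holds le w 0 ∧ (rounds p lab n).Holds le w 0 ↔
      IsControl p n w.len fun i => lab (lam i) := by
  rw [holds_control hl h0, holds_rounds hl]
  exact ⟨fun ⟨⟨h1, h2⟩, h3⟩ => ⟨h1, h2, h3⟩, fun ⟨h1, h2, h3⟩ => ⟨⟨h1, h2⟩, h3⟩⟩

end

section

variable {p : RegProg} {m : ℕ} [NeZero m] {lab : Fin m → Lab} {k : ℕ} {Δ : Type*}
  {w : DataWord (Fin m) (Fin (k + k)) Δ} {lam : ℕ → Fin m}
  (hl : ∀ i, w.IsPos i → ∀ q, q ∈ w.letter i ↔ q = lam i)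

include hl

theorem holds_linked : (linked lab k).Holds (fun a b => attrLE k a b = true) w 0 ↔
    ∀ c : Fin k, IsLinked w.len (fun i => (lab (lam i)).eff c) (segVal w) (unitVal w) c := by
  simp only [linked, holds_conj, List.mem_map, List.mem_finRange, true_and, forall_exists_index,
    forall_apply_eq_imp_iff, List.mem_cons, List.not_mem_nil, or_false, forall_eq_or_imp,
    forall_eq, holds_keepSeg hl, holds_freshSeg hl, holds_decInc hl]
  exact forall_congr' fun c => ⟨fun ⟨h1, h2, h3⟩ => ⟨h1, h2, h3⟩, fun ⟨h1, h2, h3⟩ => ⟨h1, h2, h3⟩⟩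

theorem holds_forwardLinked :
    (forwardLinked lab k).Holds (fun a b => attrLE k a b = true) w 0 ↔
    ∀ c : Fin k, c.val ≠ 0 →
      IsForwardLinked w.len (fun i => (lab (lam i)).eff c) (segVal w) (unitVal w) c := by
  simp only [forwardLinked, holds_conj, List.mem_map, List.mem_filter, List.mem_finRange, true_and,
    forall_exists_index, and_imp, forall_apply_eq_imp_iff₂, decide_eq_true_eq, holds_incDec hl]
  rfl

theorem holds_finFormula (h0 : w.IsPos 0) (n : ℕ) :
    (finFormula p lab k n).Holds (fun a b => attrLE k a b = true) w 0 ↔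
      IsControl p n w.len (fun i => lab (lam i)) ∧
      (∀ c : Fin k, IsLinked w.len (fun i => (lab (lam i)).eff c) (segVal w) (unitVal w) c) ∧
      (∀ c : Fin k, c.val ≠ 0 →
        IsForwardLinked w.len (fun i => (lab (lam i)).eff c) (segVal w) (unitVal w) c) ∧
      ∀ i, w.IsPos i → ¬ w.IsPos (i + 1) → lab (lam i) = .st [] := by
  rw [← isControl_iff hl h0, ← holds_linked hl, ← holds_forwardLinked hl]
  have hlast : (glob (or (.X tt) (isIn fun q => lab q = .st []))).Holds
      (fun a b => attrLE k a b = true) w 0 ↔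
      ∀ i, w.IsPos i → ¬ w.IsPos (i + 1) → lab (lam i) = .st [] := by
    rw [holds_glob]
    refine forall₂_congr fun i hi => ?_
    rw [holds_or, holds_isIn_of_letter (hl i hi)]
    simp only [Holds, holds_tt, and_true]
    tauto
  simp only [finFormula, Holds, holds_conj, List.mem_cons, List.not_mem_nil, or_false,
    forall_eq_or_imp, forall_eq, hlast, holds_uniqueLetter hl, true_and]
  tauto

theorem holds_infFormula (h0 : w.IsPos 0) (n : ℕ) :
    (infFormula p lab k n).Holds (fun a b => attrLE k a b = true) w 0 ↔
      IsControl p n w.len (fun i => lab (lam i)) ∧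
      (∀ c : Fin k, IsLinked w.len (fun i => (lab (lam i)).eff c) (segVal w) (unitVal w) c) ∧
      ∀ i, w.IsPos i → ∃ j, w.IsPos j ∧ i ≤ j ∧ lab (lam j) = .st [] := by
  rw [← isControl_iff hl h0, ← holds_linked hl]
  have hrec : (glob (fut (isIn fun q => lab q = .st []))).Holds
      (fun a b => attrLE k a b = true) w 0 ↔
      ∀ i, w.IsPos i → ∃ j, w.IsPos j ∧ i ≤ j ∧ lab (lam j) = .st [] := by
    rw [holds_glob]
    refine forall₂_congr fun i hi => ?_
    rw [holds_fut]
    exact exists_congr fun j => and_congr_right fun hj => and_congr_right fun _ =>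
      holds_isIn_of_letter (hl j hj)
  simp only [infFormula, Holds, holds_conj, List.mem_cons, List.not_mem_nil, or_false,
    forall_eq_or_imp, forall_eq, hrec, holds_uniqueLetter hl, true_and]
  tauto

end

/-! ### The reduction -/

/-- The input with `k` counters and the given formula. -/
def mkInput {m k : ℕ} (φ : PosFormula (Fin m) (Fin (k + k))) : Input where
  numProps := m
  numAttrs := k + k
  le := attrLE k
  isTreeOrder := attrLE_isTreeOrder k
  formula := φ

section

variable {p : RegProg} {B m : ℕ} {lab : Fin m → Lab} {Δ : Type*}

/-- Counters beyond `B` have no attributes, but no label increments or decrements them, so every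
condition on a matching is vacuous. -/
theorem exists_matching_of_isLinked (hlab : IsLabelling p B lab) {L : ℕ∞} {lam : ℕ → Fin m}
    {s u : ℕ → Fin (B + 1) → Δ}
    (h : ∀ c : Fin (B + 1), IsLinked L (fun i => (lab (lam i)).eff c) s u c) (c : ℕ) :
    ∃ m, Matching (fun i => (lab (lam i)).eff c) L m ∧
      ((∀ c : Fin (B + 1), c.val ≠ 0 → IsForwardLinked L (fun i => (lab (lam i)).eff c) s u c) →
        c ≠ 0 → ∀ i : ℕ, (i : ℕ∞) < L → (lab (lam i)).eff c = .inc →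
        ∃ j : ℕ, (j : ℕ∞) < L ∧ i < j ∧ (lab (lam j)).eff c = .dec ∧ m j = i) := by
  by_cases hc : c < B + 1
  · obtain ⟨m, h1, h2⟩ := (h ⟨c, hc⟩).exists_matching
    exact ⟨m, h1, fun hf h0 => h2 (hf ⟨c, hc⟩ h0)⟩
  · have hd : ∀ t, (lab (lam t)).eff c ≠ .dec := fun t ht => hc (hlab.bound _ _ (Or.inr ht))
    have hi : ∀ t, (lab (lam t)).eff c ≠ .inc := fun t ht => hc (hlab.bound _ _ (Or.inl ht))
    exact ⟨id, ⟨fun t _ h => absurd h (hd t), fun t _ h => absurd h (hd t),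
      fun t _ h => absurd h (hd t), fun t _ _ _ h => absurd h (hd t)⟩,
      fun _ _ i _ h => absurd h (hi i)⟩

/-- The data word that represents a run with labels `ℓ`. -/
def runWord (L : ℕ∞) (lam : ℕ → Fin m) (ℓ : ℕ → Lab) (k : ℕ) (f : ℕ × ℕ × ℕ → Δ) :
    DataWord (Fin m) (Fin (k + k)) Δ where
  len := L
  letter i := {lam i}
  data i := Fin.addCases (fun c => f (segName (fun i => (ℓ i).eff c) c i))
    (fun c => f (unitName (fun i => (ℓ i).eff c) c i))

theorem segVal_runWord (L : ℕ∞) (lam : ℕ → Fin m) (ℓ : ℕ → Lab) (k : ℕ) (f : ℕ × ℕ × ℕ → Δ) :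
    segVal (runWord L lam ℓ k f) = fun i (c : Fin k) => f (segName (fun i => (ℓ i).eff c) c i) := by
  funext i c
  simp only [segVal, runWord, Fin.addCases_left]

theorem unitVal_runWord (L : ℕ∞) (lam : ℕ → Fin m) (ℓ : ℕ → Lab) (k : ℕ) (f : ℕ × ℕ × ℕ → Δ) :
    unitVal (runWord L lam ℓ k f) = fun i (c : Fin k) => f (unitName (fun i => (ℓ i).eff c) c i) := by
  funext i c
  simp only [unitVal, runWord, Fin.addCases_right]

variable [NeZero m]

theorem Eff.ok_of {x : Eff} {v : ℕ} (h1 : x = .dec → 0 < v) (h2 : x = .zero → v = 0) :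
    x.Ok v := by
  cases x <;> simp_all [Eff.Ok]

/-- This is why the budget needs no forward links; the constructed finite run ends with a positive
budget and could not provide them. -/
theorem Lab.eff_zero_ne_zero (x : Lab) : x.eff 0 ≠ .zero := by
  cases x with
  | st s =>
    match s with
    | .inc r :: _ | .dec r :: _ | .zero r :: _ => simp [Lab.eff, stEff]
    | [] | .skip :: _ | .seq _ _ :: _ | .star _ :: _ => simp [Lab.eff, stEff]
  | _ => simp [Lab.eff]

theorem exec_of_finSat (hlab : IsLabelling p B lab) {n : ℕ}
    (h : (mkInput (finFormula p lab (B + 1) n)).FinSat Δ) :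
    ∃ τ, p.Exec (Function.update (0 : ℕ → ℕ) 0 n) τ := by
  obtain ⟨w, hfin, h0, hw⟩ := h
  change DataWord (Fin m) (Fin (B + 1 + (B + 1))) Δ at w
  change (finFormula p lab (B + 1) n).Holds (fun a b => attrLE (B + 1) a b = true) w 0 at hw
  obtain ⟨lam, hl⟩ : ∃ lam : ℕ → Fin m, ∀ i, w.IsPos i → ∀ q, q ∈ w.letter i ↔ q = lam i := by
    have := hw
    simp only [finFormula, Holds] at this
    exact exists_lam_of_uniqueLetter ((holds_conj _).1 this.1 _ (by simp))
  obtain ⟨h1, h2, h3, h4⟩ := (holds_finFormula hl h0 n).1 hw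
  obtain ⟨N, hN⟩ := ENat.ne_top_iff_exists.1 hfin.ne
  have hpos : ∀ i, w.IsPos i ↔ i < N := fun i => by
    rw [DataWord.IsPos, ← hN]; exact Nat.cast_lt
  obtain ⟨L, rfl⟩ : ∃ L, N = L + 1 := ⟨N - 1, by have := (hpos 0).1 h0; omega⟩
  rw [← hN] at h1
  refine exec_of_finite_run h1 (h4 L ((hpos _).2 (by omega)) (by rw [hpos]; omega))
    fun t ht c => ?_
  obtain ⟨mt, hm1, hm2⟩ := exists_matching_of_isLinked hlab h2 c
  have htL : (t : ℕ∞) < w.len := (hpos t).2 (by omega)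
  refine Eff.ok_of (hm1.val_pos htL) fun hz => hm1.val_eq_zero (hm2 h3 ?_) htL hz
  rintro rfl
  exact Lab.eff_zero_ne_zero _ hz

theorem exec_of_infSat (hlab : IsLabelling p B lab) {n : ℕ}
    (h : (mkInput (infFormula p lab (B + 1) n)).InfSat Δ) :
    ∃ τ, p.Exec (Function.update (0 : ℕ → ℕ) 0 n) τ := by
  obtain ⟨w, htop, h0, hw⟩ := h
  change DataWord (Fin m) (Fin (B + 1 + (B + 1))) Δ at w
  change (infFormula p lab (B + 1) n).Holds (fun a b => attrLE (B + 1) a b = true) w 0 at hw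
  obtain ⟨lam, hl⟩ : ∃ lam : ℕ → Fin m, ∀ i, w.IsPos i → ∀ q, q ∈ w.letter i ↔ q = lam i := by
    have := hw
    simp only [infFormula, Holds] at this
    exact exists_lam_of_uniqueLetter ((holds_conj _).1 this.1 _ (by simp))
  obtain ⟨h1, h2, h3⟩ := (holds_infFormula hl h0 n).1 hw
  have hpos : ∀ i, w.IsPos i := fun i => by
    rw [DataWord.IsPos, htop]; exact ENat.natCast_lt_top i
  refine exec_of_infinite_run (htop ▸ h1) (fun t => ?_) (fun t c => hlab.bound _ c)
    fun t c hd => ?_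
  · obtain ⟨j, -, h4, h5⟩ := h3 t (hpos t)
    exact ⟨j, h4, h5⟩
  -- Backward links give positivity at decrements, and nothing about zero tests is needed here.
  · obtain ⟨mt, hm1, -⟩ := exists_matching_of_isLinked hlab h2 c
    exact hm1.val_pos (hpos t) hd

theorem exists_lam_of_isRun (hlab : IsLabelling p B lab) {n : ℕ} {L : ℕ∞}
    {g : ℕ → Lab × (ℕ → ℕ)} (h : IsRun p n L g) :
    ∃ lam : ℕ → Fin m, ∀ t : ℕ, (t : ℕ∞) < L → lab (lam t) = (g t).1 := by
  have key : ∀ t : ℕ, (t : ℕ∞) < L → ∃ q, lab q = (g t).1 := by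
    intro t
    induction t with
    | zero => rw [h.init]; exact fun _ => hlab.pre
    | succ t ih =>
      intro ht
      obtain ⟨q, hq⟩ := ih (natCast_lt_of_le ht (by omega))
      exact hlab.closed q _ (hq ▸ (h.step t ht).adj)
  choose! lam hlam using key
  exact ⟨lam, hlam⟩

/-- `lam` names the labels of a run only at positions of the word, so properties have to be
transferred below `L`. -/
theorem IsControl.congr {n : ℕ} {L : ℕ∞} {ℓ ℓ' : ℕ → Lab} (h : IsControl p n L ℓ) (hL : 0 < L)
    (he : ∀ t : ℕ, (t : ℕ∞) < L → ℓ' t = ℓ t) : IsControl p n L ℓ' := by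
  refine ⟨?_, fun t ht => ?_, fun i hi hm => ?_⟩
  · rw [he 0 hL]; exact h.init
  · rw [he t (natCast_lt_of_le ht (by omega)), he _ ht]; exact h.adj t ht
  · rw [he i hi] at hm
    obtain ⟨h1, h2, h3⟩ := h.load i hi hm
    refine ⟨h1, fun d hd => ?_, ?_⟩
    · rw [he _ (natCast_lt_of_le h1 (by omega))]; exact h2 d hd
    · rw [he _ h1]; exact h3

theorem IsLinked.congr {k : ℕ} {L : ℕ∞} {e e' : ℕ → Eff} {s u : ℕ → Fin k → Δ} {c : Fin k}
    (h : IsLinked L e s u c) (he : ∀ t : ℕ, (t : ℕ∞) < L → e' t = e t) : IsLinked L e' s u c := by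
  refine ⟨fun i hi => ?_, fun i hi hz => h.fresh i hi (he i hi ▸ hz), fun i hi hd => ?_⟩
  · rw [he _ hi]; exact h.keep i hi
  · obtain ⟨j, hj, h1, h2⟩ := h.back i hi (he i hi ▸ hd)
    exact ⟨j, hj, by rw [he j (natCast_lt_of_le hi hj.le)]; exact h1, h2⟩

theorem IsForwardLinked.congr {k : ℕ} {L : ℕ∞} {e e' : ℕ → Eff} {s u : ℕ → Fin k → Δ} {c : Fin k}
    (h : IsForwardLinked L e s u c) (he : ∀ t : ℕ, (t : ℕ∞) < L → e' t = e t) :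
    IsForwardLinked L e' s u c := by
  intro i hi hinc
  obtain ⟨j, hj, h1, h2, h3⟩ := h i hi (he i hi ▸ hinc)
  exact ⟨j, hj, h1, by rw [he j h1]; exact h2, h3⟩

theorem exists_name_injection (Δ : Type*) [Infinite Δ] :
    ∃ f : ℕ × ℕ × ℕ → Δ, Function.Injective f :=
  ⟨fun x => Infinite.natEmbedding Δ (Encodable.encode x),
    (Infinite.natEmbedding Δ).injective.comp Encodable.encode_injective⟩

theorem finSat_of_exec [Infinite Δ] (hlab : IsLabelling p B lab) {n : ℕ}
    (h : p.Exec (Function.update (0 : ℕ → ℕ) 0 n) 0) :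
    (mkInput (finFormula p lab (B + 1) n)).FinSat Δ := by
  obtain ⟨T, g, hg⟩ := exists_finite_isRun hlab.pos hlab.head h
  obtain ⟨lam, hlam⟩ := exists_lam_of_isRun hlab hg
  obtain ⟨f, hf⟩ := exists_name_injection Δ
  set ℓ : ℕ → Lab := fun i => (g i).1 with hℓ
  have h0 : (0 : ℕ∞) < (T + 1 : ℕ) := by exact_mod_cast Nat.succ_pos T
  have hT : (T : ℕ∞) < (T + 1 : ℕ) := by exact_mod_cast Nat.lt_succ_self T
  have hlast := hg.last T hT (lt_irrefl _)
  refine ⟨runWord (T + 1 : ℕ) lam ℓ (B + 1) f, ENat.natCast_lt_top _, h0,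
    (holds_finFormula (w := runWord (T + 1 : ℕ) lam ℓ (B + 1) f) (lam := lam) (fun i _ q => Iff.rfl) h0 n).2 ⟨?_, fun c => ?_, fun c hc => ?_,
      fun i hi hi' => ?_⟩⟩
  · exact hg.isControl.congr h0 hlam
  · rw [segVal_runWord, unitVal_runWord]
    exact (isLinked_names (e := fun c i => (ℓ i).eff c) hf c fun t ht => hg.ok c t ht).congr
      fun t ht => by rw [hlam t ht]
  · rw [segVal_runWord, unitVal_runWord]
    refine (isForwardLinked_names (e := fun c i => (ℓ i).eff c) hf c (fun t ht => hg.ok c t ht)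
      rfl ?_ ?_).congr fun t ht => by rw [hlam t ht]
    · exact (hg.vals_eq c T hT).trans (hlast.2 c hc)
    · simp only [hℓ, hlast.1]
      rfl
  · rw [hlam i hi]
    exact (hg.last i hi hi').1

theorem infSat_of_exec [Infinite Δ] (hlab : IsLabelling p B lab) {n : ℕ}
    (h : p.Exec (Function.update (0 : ℕ → ℕ) 0 n) 0) :
    (mkInput (infFormula p lab (B + 1) n)).InfSat Δ := by
  obtain ⟨g, hg, hrec⟩ := exists_infinite_isRun hlab.pos hlab.head h
  obtain ⟨lam, hlam⟩ := exists_lam_of_isRun hlab hg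
  obtain ⟨f, hf⟩ := exists_name_injection Δ
  set ℓ : ℕ → Lab := fun i => (g i).1 with hℓ
  have h0 : (0 : ℕ∞) < ⊤ := ENat.natCast_lt_top 0
  refine ⟨runWord ⊤ lam ℓ (B + 1) f, rfl, h0,
    (holds_infFormula (w := runWord ⊤ lam ℓ (B + 1) f) (lam := lam) (fun i _ q => Iff.rfl) h0 n).2 ⟨?_, fun c => ?_,
      fun i _ => ?_⟩⟩
  · exact hg.isControl.congr h0 hlam
  · rw [segVal_runWord, unitVal_runWord]
    exact (isLinked_names (e := fun c i => (ℓ i).eff c) hf c fun t ht => hg.ok c t ht).congr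
      fun t ht => by rw [hlam t ht]
  · obtain ⟨j, hij, hj⟩ := hrec i
    exact ⟨j, ENat.natCast_lt_top _, hij, (hlam j (ENat.natCast_lt_top _)).trans hj⟩

/-- Only `rounds` depends on `n`. In prefix notation `loads` comes last, so the code is a constant
string followed by the code of `loads p lab n`, and each load prepends a constant string to the
latter. -/
theorem computable_code {k : ℕ} (φ : PosFormula (Fin m) (Fin (k + k))) :
    Computable fun n => (mkInput (.and φ (rounds p lab n))).code := by
  have h1 : ∀ n, (loads p lab n : PosFormula (Fin m) (Fin (k + k))).code =
      Nat.rec (loads p lab 0 : PosFormula (Fin m) (Fin (k + k))).code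
        (fun _ l => (3 :: 1 :: (isIn fun q => lab q = .load : PosFormula (Fin m)
          (Fin (k + k))).code) ++ l) n := by
    intro n
    induction n with
    | zero => rfl
    | succ n ih =>
      simp only [← ih]
      simp [loads, PosFormula.code]
  have h2 : Computable fun n => (loads p lab n : PosFormula (Fin m) (Fin (k + k))).code := by
    refine Primrec.to_comp ((Primrec.nat_rec₁ _ ?_).of_eq fun n => (h1 n).symm)
    exact Primrec.list_append.comp₂ (Primrec₂.const _) Primrec₂.right
  obtain ⟨l, hl⟩ : ∃ l : List ℕ, ∀ n, (mkInput (.and φ (rounds p lab n))).code =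
      l ++ (loads p lab n : PosFormula (Fin m) (Fin (k + k))).code := by
    refine ⟨(m :: (k + k) :: ((List.finRange (k + k)).flatMap
      (fun x => (List.finRange (k + k)).map (fun y => (attrLE k x y).toNat)) ++
      (1 :: (φ.code ++ (2 :: 5 :: ((tt : PosFormula (Fin m) (Fin (k + k))).code ++
        (2 :: 2 :: 1 :: ((isIn fun q => lab q = .mark : PosFormula (Fin m)
          (Fin (k + k))).code ++ [2])))))))), fun n => ?_⟩
    simp [Input.code, mkInput, PosFormula.code, rounds, glob, fut, imp]
  exact (Computable.list_append.comp (Computable.const l) h2).of_eq fun n => (hl n).symm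

end

/-- A decision procedure for a set of inputs decides all problems that are reduced to it. -/
theorem DecidableOn.computablePred {D : Set Input} {P : Input → Prop} (h : DecidableOn D P)
    {I : ℕ → Input} (hI : Computable fun n => (I n).code) (hD : ∀ n, I n ∈ D) {Q : ℕ → Prop}
    (hQ : ∀ n, P (I n) ↔ Q n) : ComputablePred Q := by
  obtain ⟨f, hf, hfP⟩ := h
  refine ComputablePred.computable_iff.2 ⟨fun n => f (I n).code, hf.comp hI, ?_⟩
  funext n
  exact propext ((hQ n).symm.trans (hfP _ (hD n)).symm)

theorem DecidableOn.mono {D D' : Set Input} {P : Input → Prop} (h : DecidableOn D P)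
    (hD : D' ⊆ D) : DecidableOn D' P :=
  h.imp fun _ hf => ⟨hf.1, fun I hI => hf.2 I (hD hI)⟩

end NDLTL

theorem mainTheorem5 (Δ : Type*) [Infinite Δ] :
    ¬ NDLTL.DecidableOn Set.univ (NDLTL.Input.FinSat Δ) ∧
    ¬ NDLTL.DecidableOn Set.univ (NDLTL.Input.InfSat Δ) ∧
    ¬ NDLTL.DecidableOn {I | I.formula.IsMinus} (NDLTL.Input.InfSat Δ) := by
  obtain ⟨p, hp, hund⟩ := NDLTL.RegProg.exists_undecidable_prog
  obtain ⟨B, m, _, lab, hlab⟩ := NDLTL.exists_labelling p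
  -- The formulae for infinite words already lie in the fragment, so the unrestricted problem
  -- inherits undecidability. By `hp`, every terminating execution ends in `0`, as `infSat_of_exec`
  -- requires.
  have hminus : ¬ NDLTL.DecidableOn {I | I.formula.IsMinus} (NDLTL.Input.InfSat Δ) := fun h =>
    hund (h.computablePred (I := fun n => NDLTL.mkInput (NDLTL.infFormula p lab (B + 1) n))
      (NDLTL.computable_code _) (NDLTL.isMinus_infFormula p lab (B + 1))
      fun n => ⟨NDLTL.exec_of_infSat hlab,
        fun ⟨τ, hτ⟩ => NDLTL.infSat_of_exec hlab (hp n τ hτ ▸ hτ)⟩)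
  refine ⟨fun h => ?_, fun h => hminus (h.mono (Set.subset_univ _)), hminus⟩
  exact hund (h.computablePred (I := fun n => NDLTL.mkInput (NDLTL.finFormula p lab (B + 1) n))
    (NDLTL.computable_code _) (fun _ => trivial)
    fun n => ⟨NDLTL.exec_of_finSat hlab,
      fun ⟨τ, hτ⟩ => NDLTL.finSat_of_exec hlab (hp n τ hτ ▸ hτ)⟩)
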